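/- Let $n\ge 2$ and let $W$ be the Weyl group of type $D_n$, acting on $\mathbb{Z}^n$ with basis $e_1,\dots,e_n$ by permutations and even sign changes, with positive roots $e_i\pm e_j$ ($i<j$) and Weyl vector $\rho=(n-1,n-2,\dots,1,0)$. For $0\le 2k\le n$ put $\lambda_k=e_1+\dots+e_{2k}$ (so $\lambda_k=\omega_{2k}$ for $0<2k<n-1$, $\lambda_k=\omega_{n-1}+\omega_n$ for $2k=n-1$, and $\lambda_k=2\omega_n$ for $2k=n$). For a dominant weight $\lambda$, the minuscule (Stembridge) recurrence for $\lambda$ and the minuscule coweight $e_1$ is $$\sum_i C_{w_i\lambda}\sum_{\psi\in W_\lambda e_1}\left(t^{-(\rho,w_i\psi)}-q^{(\lambda,e_1)}t^{(\rho,w_i\psi)}\right)=0,$$ where $W_\lambda$ is the stabilizer of $\lambda$ and the $w_i$ are the minimal coset representatives of $W/W_\lambda$. Its reduced form is obtained by replacing $C_\mu$ by $(-1)^{\ell(\sigma)}C_\nu$ if $\sigma(\mu+\rho)=\nu+\rho$ with $\sigma\in W$ and $\nu$ dominant, and by $0$ if $\mu+\rho$ is not regular. Write $C_i=C_{\lambda_i}$,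 and for $i\ge 1$ let $R_i$ be the left-hand side of the recurrence for $\lambda_i$ with $q\to-q$, $t\to q^2$, in reduced form: a linear form over $\mathbb{C}(q)$ in the symbols $C_\nu$, $\nu$ dominant. Let $\Lambda_h^{k,n}$ be the coefficient of $C_h$ in $R_k$. Let $\Omega_h^{k,n}$ be the set of $\mu\in W\lambda_k$ such that $\mu+\rho$ and $\lambda_h+\rho$ lie in the same $W$-orbit, and put $\Theta(n,k,h)=|\Omega_0^{k-h,\,n-2h}|$. Define integers $A_h^{k,n}$ by $A_h^{k,n}=0$ if $h>k$ or $h\le 0$, $A_k^{k,n}=1$ if $k\geq 1$, and $$A_h^{k,n}=-\sum_{i=h+1}^k(-1)^{i-h}\,\Theta(n,i,h)\,A_i^{k,n}\qquad(0<h<k).$$ Finally set $$b_{k,n}=\begin{cases}\dfrac{q^{4k}-1}{q^{2k-1}(q-1)} & \text{if } n=2k,\\[2mm] \dfrac{(q^{2n}-1)(q^{2(n-2k)}+1)}{q^{2(n-k)-1}(q-1)} & \text{otherwise.}\end{cases}$$ Then, for all $k\ge 1$ with $2k\le n$, the following identity of linear forms holds: $$\sum_{i=1}^k A_i^{k,n}R_i=\Lambda_k^{k,n}C_k-\sum_{i=0}^{k-1}b_{k-i,\,n-2i}\,C_i,\qquad\text{where}\qquad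 \Lambda_k^{k,n}=\frac{(q^{4k}-1)(q^{4(n-k)-1}+1)}{q^{2(n-1)}(q^2-1)}.$$ Consequently the same identity holds for the values in $\mathbb{C}(q)$ of every family $(C_\mu)_{\mu\in\mathbb{Z}^n}$ obeying the above rule, with $R_i$ then the value of the (unreduced) left-hand side of the recurrence for $\lambda_i$. -/

import Mathlib

namespace TypeD

/-- Integral weights of `D_n`, in coordinates with respect to `e_1, …, e_n`
(coordinate `e_{i+1}` has index `i : Fin n`). -/
abbrev Weight (n : ℕ) : Type := Fin n → ℤ

/-- The Weyl group of type `D_n`: permutations of the coordinates together with an even number of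
sign changes. -/
abbrev WeylGroup (n : ℕ) : Type :=
  {w : (Fin n → ℤˣ) × Equiv.Perm (Fin n) // ∏ i, w.1 i = 1}

/-- The action on weights: `w = (s, π)` sends `e_j` to `s (π j) • e_{π j}`. -/
def act {n : ℕ} (w : WeylGroup n) (v : Weight n) : Weight n :=
  fun i => (w.1.1 i : ℤ) * v (w.1.2.symm i)

/-- The sign `(-1)^{l(w)}`, which is the determinant of `w` (see `det_act`); as the number of sign
changes is even, it is the sign of the underlying permutation. -/
def weylSign {n : ℕ} (w : WeylGroup n) : ℤ := (Equiv.Perm.sign w.1.2 : ℤ)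

/-- The matrix of `act w` has determinant `weylSign w`. -/
theorem det_act {n : ℕ} (w : WeylGroup n) :
    Matrix.det (Matrix.of fun i j => act w (Pi.single j 1) i) = weylSign w := by
  have h : (Matrix.of fun i j => act w (Pi.single j 1) i) =
      Matrix.of fun i j => (w.1.1 i : ℤ) *
        ((1 : Matrix (Fin n) (Fin n) ℤ).submatrix w.1.2.symm id) i j := by
    ext i j
    simp [act, Matrix.one_apply, Pi.single_apply]
  have hs : (∏ i, (w.1.1 i : ℤ)) = 1 := by
    have := congrArg (fun u : ℤˣ => (u : ℤ)) w.2
    simpa using this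
  rw [h, Matrix.det_mul_column, hs, Matrix.det_permute]
  simp [weylSign]

/-- The Weyl vector `ρ = (n-1, n-2, …, 1, 0)`, half the sum of the positive roots `e_i ± e_j`,
`i < j`. -/
def rho (n : ℕ) : Weight n := fun i => (n : ℤ) - 1 - (i.val : ℤ)

/-- The inner product, for which `e_1, …, e_n` is orthonormal. -/
def pair {n : ℕ} (v w : Weight n) : ℤ := ∑ i, v i * w i

/-- The minuscule coweight `e_1`. -/
def e1 (n : ℕ) : Weight n := fun i => if i.val = 0 then 1 else 0

/-- `μ` is dominant: it pairs nonnegatively with all positive roots `e_i ± e_j`, `i < j`. -/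
def IsDominant {n : ℕ} (μ : Weight n) : Prop :=
  ∀ i j : Fin n, i < j → 0 ≤ μ i - μ j ∧ 0 ≤ μ i + μ j

/-- `v` is regular: it is orthogonal to no root. -/
def IsRegular {n : ℕ} (v : Weight n) : Prop :=
  ∀ i j : Fin n, i < j → v i - v j ≠ 0 ∧ v i + v j ≠ 0

/-- The dominant weight `e_1 + ⋯ + e_{2k}`: this is `0` for `k = 0`, `ω_{2k}` for `0 < 2k < n - 1`,
`ω_{n-1} + ω_n` for `2k = n - 1` and `2 ω_n` for `2k = n`. -/
def omega (n k : ℕ) : Weight n := fun i => if i.val < 2 * k then 1 else 0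

/-- The orbit `W λ`. -/
def orbit {n : ℕ} (lam : Weight n) : Finset (Weight n) :=
  Finset.univ.image fun w : WeylGroup n => act w lam

/-- `μ` is conjugated to `ν`, i.e. `μ + ρ ∼ ν + ρ`. -/
def Conj {n : ℕ} (μ ν : Weight n) : Prop :=
  ∃ w : WeylGroup n, act w (μ + rho n) = ν + rho n

open Classical in
/-- `Omega n k h` is `Ω_h^{k,n}`, the set of the weights in the orbit of `ω_{2k}` that are
conjugated to `ω_{2h}`. -/
noncomputable def Omega (n k h : ℕ) : Finset (Weight n) :=
  (orbit (omega n k)).filter fun μ => Conj μ (omega n h)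

/-- `Θ(n,k,h) = |Ω_0^{k-h,n-2h}|` (used for `h ≤ k`, `2k ≤ n`). -/
noncomputable def Theta (n k h : ℕ) : ℕ := (Omega (n - 2 * h) (k - h) 0).card

/-- The integers `A_h^{k,n}`: `0` if `h > k` or `h ≤ 0`, `1` if `h = k`, and
`-∑_{i=h+1}^k (-1)^{i-h} Θ(n,i,h) A_i^{k,n}` otherwise. -/
noncomputable def A (n k h : ℕ) : ℤ :=
  if k < h ∨ h = 0 then 0
  else if h = k then 1
  else -∑ i ∈ (Finset.Ioc h k).attach, (-1) ^ (i.1 - h) * (Theta n i.1 h : ℤ) * A n k i.1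
termination_by k - h
decreasing_by
  have := Finset.mem_Ioc.mp i.2
  omega

section Recurrence

variable {K : Type*} [Field K]

/-- The coefficient of `C_μ`, `μ = w_i λ`, in the minuscule recurrence for `λ` and the minuscule
coweight `e_1`: `∑_{ψ ∈ W_λ e_1} (t^{-(ρ, w_i ψ)} - q^{(λ, e_1)} t^{(ρ, w_i ψ)})`.
The set `{w_i ψ | ψ ∈ W_λ e_1}` is written as `{w e_1 | w ∈ W, w λ = μ}`, because the `w` with
`w λ = μ = w_i λ` make up the coset `w_i W_λ`. -/
def minusculeCoeff (q t : K) {n : ℕ} (lam μ : Weight n) : K :=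
  ∑ φ ∈ (Finset.univ.filter fun w : WeylGroup n => act w lam = μ).image fun w => act w (e1 n),
    (t ^ (-(pair (rho n) φ)) - q ^ (pair lam (e1 n)) * t ^ (pair (rho n) φ))

/-- The left-hand side of the minuscule recurrence for `λ`, before reduction, as a linear form in
the symbols `C_μ`: the symbol `C_μ` is the basis vector `Finsupp.single μ 1`. -/
noncomputable def minusculeRecurrence (q t : K) {n : ℕ} (lam : Weight n) : Weight n →₀ K :=
  ∑ μ ∈ orbit lam, Finsupp.single μ (minusculeCoeff q t lam μ)

open Classical in
/-- The reduced form of the symbol `C_μ`: it is `(-1)^{l(σ)} C_λ` if `σ(μ + ρ) = λ + ρ` with `λ`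
dominant and `σ` in the Weyl group, and `0` if there is no such pair `(σ, λ)`, i.e. if `μ + ρ` is
not regular. (The pair `(σ, λ)` is unique when it exists.) -/
noncomputable def reducedSymbol (K : Type*) [Field K] {n : ℕ} (μ : Weight n) : Weight n →₀ K :=
  if h : ∃ p : WeylGroup n × Weight n, IsDominant p.2 ∧ act p.1 (μ + rho n) = p.2 + rho n then
    Finsupp.single h.choose.2 (weylSign h.choose.1 : K)
  else 0

/-- Writing all the symbols of a linear form in their reduced form. -/
noncomputable def reduce {n : ℕ} : (Weight n →₀ K) →ₗ[K] (Weight n →₀ K) :=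
  Finsupp.linearCombination K (reducedSymbol K)

/-- A family `C_μ`, indexed by all weights, that is obtained from its values at the dominant
weights by the rule `C_μ = 0` if `μ + ρ` is not regular, `C_μ = (-1)^{l(σ)} C_λ` if
`σ(μ + ρ) = λ + ρ` with `λ` dominant. -/
def IsExtendedFamily {n : ℕ} (C : Weight n → K) : Prop :=
  (∀ μ : Weight n, ¬ IsRegular (μ + rho n) → C μ = 0) ∧
  ∀ (μ lam : Weight n) (w : WeylGroup n), IsDominant lam →
    act w (μ + rho n) = lam + rho n → C μ = (weylSign w : K) * C lam

end Recurrence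

/-- The field `ℂ(q)`. -/
abbrev Kq : Type := RatFunc ℂ

/-- The variable `q`. -/
noncomputable def q : Kq := RatFunc.X

/-- The symbol `C_i`, i.e. `C_λ` for `λ = ω_{2i}` (`λ = 2 ω_n` if `n = 2i`). -/
noncomputable def Csym (n i : ℕ) : Weight n →₀ Kq := Finsupp.single (omega n i) 1

/-- `R_i`: the minuscule recurrence for `C_i` in `D_n`, evaluated at `q → -q`, `t → q^2` and
written in reduced form. -/
noncomputable def R (n i : ℕ) : Weight n →₀ Kq :=
  reduce (minusculeRecurrence (-q) (q ^ 2) (omega n i))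

/-- `Lambda n k h` is `Λ_h^{k,n}`, the coefficient of `C_h` in `R_k`. -/
noncomputable def Lambda (n k h : ℕ) : Kq := R n k (omega n h)

/-- The coefficients `b_{k,n}`. -/
noncomputable def b (k n : ℕ) : Kq :=
  if n = 2 * k then
    (q ^ (4 * (k : ℤ)) - 1) / (q ^ (2 * (k : ℤ) - 1) * (q - 1))
  else
    (q ^ (2 * (n : ℤ)) - 1) * (q ^ (2 * ((n : ℤ) - 2 * k)) + 1) /
      (q ^ (2 * ((n : ℤ) - k) - 1) * (q - 1))

end TypeD

/-!
Write `r` for the value of `ρ` at a coordinate. For `μ` with coordinates in `{-1, 0, 1}` the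
shifted weight `μ + ρ` is regular only if `|μ_r + r|` is injective in `r`. This forces a run of
ones at the top, which moves the entries of `ρ` up, followed by exchanges of disjoint pairs of
neighbouring entries `r + 1, r` (`mem_shifted_of_isRegular`); the pair `1, 0` can be exchanged in
two ways, as the entry `0` has no sign. The run through all coordinates may also end with `-1`,
which the parity condition on the orbits of the `omega n k` excludes. If `μ` lies in the orbit of
`omega n k` and its run has length `2h`, there are `k - h` exchanges, each a transposition, so
that `C_μ` reduces to `(-1)^(k-h) C_h` (`reducedSymbol_eq_sum`). Its coefficient in the recurrence
is a sum over the nonzero coordinates (`minusculeCoeff_omega`), hence a part depending only on the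
run plus a contribution `e_r = edgeCoeff` of each exchange.

The signed generating polynomial of the sets of exchanges, by the number of zero coordinates,
obeys the recursion of the Chebyshev polynomials normalised by `C_n(z + 1/z) = z^n + z^(-n)` and
equals `C_n` for `n ≥ 1` (`genPoly_eq_chebyshev`). Weighted by the sum of the contributions it
satisfies `F_(n+2) = X F_(n+1) - F_n - e_n C_n`, whose solution is `F_n = -∑_(0<h<n) S_h C_(n-2h)`
with `S_h = e_0 + ⋯ + e_(h-1)` (`genPoly_weightCoeff`). For `n = 2k` all coordinates are nonzero,
the parity condition on the orbit selects one of the two exchanges of the last pair, and the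
counts for shorter runs are halved (`sum_Omega_zero`).

The recursion for `A` says that the linear functional `dualA`, built from the numbers `A n k i`,
annihilates every `C_(n-2l)` with `h < l < k` and maps `C_(n-2k)` to `1` (`dualA_chebyshev_C`).
Therefore the parts coming from the runs cancel, and, since `C_(-m) = C_m`, the functional applied
to `F_(n-2h)` leaves `-(S_(k-h) + S_(n-h-k))`, or `-S_(k-h)` if `n = 2k` (`dualA_edgePoly`). These
are geometric sums with the value `-b (k-h) (n-2h)` (`b_eq`).
-/

/-! ### Conjugacy with signs and reduced symbols -/

namespace TypeD

/-- `v'` is the image of `v` under a Weyl group element of sign `ε`. -/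
def ConjSign {n : ℕ} (ε : ℤ) (v v' : Weight n) : Prop :=
  ∃ w : WeylGroup n, act w v = v' ∧ weylSign w = ε

theorem ConjSign.of_perm {n : ℕ} (s : Fin n → ℤˣ) (π : Equiv.Perm (Fin n)) (hs : ∏ i, s i = 1)
    {v v' : Weight n} (h : ∀ i, v' i = (s i : ℤ) * v (π.symm i)) :
    ConjSign (Equiv.Perm.sign π : ℤ) v v' :=
  ⟨⟨(s, π), hs⟩, funext fun i => (h i).symm, rfl⟩

theorem ConjSign.refl {n : ℕ} (v : Weight n) : ConjSign 1 v v := by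
  simpa using ConjSign.of_perm (v := v) (v' := v) (fun _ => 1) (Equiv.refl _) (by simp) (by simp)

theorem ConjSign.trans {n : ℕ} {ε ε' : ℤ} {u v w : Weight n} (h : ConjSign ε u v)
    (h' : ConjSign ε' v w) : ConjSign (ε * ε') u w := by
  obtain ⟨⟨⟨s, π⟩, hs⟩, rfl, rfl⟩ := h
  obtain ⟨⟨⟨s', π'⟩, hs'⟩, rfl, rfl⟩ := h'
  have := ConjSign.of_perm (v := u) (fun i => s' i * s (π'.symm i)) (π' * π)
    (by rw [Finset.prod_mul_distrib, Equiv.prod_comp π'.symm s]; simp_all) (fun i => rfl)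
  convert this using 1
  · simp [weylSign, mul_comm]
  · ext i
    simp [act, Equiv.Perm.mul_def, mul_assoc]

theorem ConjSign.symm {n : ℕ} {ε : ℤ} {u v : Weight n} (h : ConjSign ε u v) :
    ConjSign ε v u := by
  obtain ⟨⟨⟨s, π⟩, hs⟩, rfl, rfl⟩ := h
  have := ConjSign.of_perm (v := act ⟨(s, π), hs⟩ u) (v' := u) (fun i => s (π i)) π⁻¹
    (by rw [Equiv.prod_comp π s]; exact hs) (fun i => by
      simp [act, ← mul_assoc, Int.units_coe_mul_self, Equiv.Perm.inv_def])
  simpa [weylSign] using this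

theorem ConjSign.cons {n : ℕ} {ε : ℤ} {u v : Weight n} (h : ConjSign ε u v) (x : ℤ) :
    ConjSign (n := n + 1) ε (Fin.cons x u) (Fin.cons x v) := by
  obtain ⟨⟨⟨s, π⟩, hs⟩, rfl, rfl⟩ := h
  have := ConjSign.of_perm (v := (Fin.cons x u : Weight (n + 1)))
    (v' := Fin.cons x (act ⟨(s, π), hs⟩ u)) (Fin.cons 1 s)
    (Equiv.Perm.decomposeFin.symm (0, π)) (by simp_all [Fin.prod_univ_succ]) (fun i => by
      refine Fin.cases ?_ (fun j => ?_) i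
      · have : (Equiv.Perm.decomposeFin.symm (0, π)).symm 0 = 0 := by
          rw [Equiv.symm_apply_eq]; simp
        simp [this]
      · have : (Equiv.Perm.decomposeFin.symm (0, π)).symm j.succ = (π.symm j).succ := by
          rw [Equiv.symm_apply_eq]; simp
        simp [this, act])
  simpa [weylSign, Equiv.Perm.decomposeFin.symm_sign] using this

theorem ConjSign.swap {n : ℕ} (x y : ℤ) (u : Weight n) :
    ConjSign (n := n + 2) (-1) (Fin.cons x (Fin.cons y u)) (Fin.cons y (Fin.cons x u)) := by
  have := ConjSign.of_perm (n := n + 2) (v := Fin.cons x (Fin.cons y u))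
    (v' := Fin.cons y (Fin.cons x u)) (fun _ => 1) (Equiv.swap 0 1) (by simp) (fun i => by
      refine Fin.cases ?_ (fun j => ?_) i
      · simp
      · refine Fin.cases ?_ (fun j => ?_) j
        · simp
        · rw [Equiv.symm_swap, Equiv.swap_apply_of_ne_of_ne]
          · simp
          · simp [Fin.ext_iff]
          · simp [Fin.ext_iff])
  simpa using this

theorem weylSign_mul_self {n : ℕ} (w : WeylGroup n) : weylSign w * weylSign w = 1 := by
  simp [weylSign]

theorem IsRegular.act {n : ℕ} {v : Weight n} (hv : IsRegular v) (w : WeylGroup n) :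
    IsRegular (act w v) := by
  obtain ⟨⟨s, π⟩, hs⟩ := w
  have key : ∀ i j : Fin n, i ≠ j → v i - v j ≠ 0 ∧ v i + v j ≠ 0 := by
    intro i j hij
    rcases lt_or_gt_of_ne hij with h | h
    · exact hv i j h
    · have := hv j i h
      constructor <;> [have := this.1; have := this.2] <;> omega
  intro i j hij
  have := key (π.symm i) (π.symm j) (by simpa using hij.ne)
  simp only [TypeD.act]
  rcases Int.units_eq_one_or (s i) with h1 | h1 <;>
    rcases Int.units_eq_one_or (s j) with h2 | h2 <;> simp only [h1, h2] <;>
    constructor <;> (try push_cast) <;> omega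

theorem IsDominant.isRegular {n : ℕ} {μ : Weight n} (h : IsDominant μ) :
    IsRegular (μ + rho n) := by
  intro i j hij
  have := h i j hij
  have hi := i.2
  have hj := j.2
  have : i.val < j.val := hij
  simp only [Pi.add_apply, rho]
  omega

theorem IsRegular.of_conjSign {n : ℕ} {ε : ℤ} {u v : Weight n} (h : ConjSign ε u v)
    (hu : IsRegular u) : IsRegular v := by
  obtain ⟨w, rfl, -⟩ := h
  exact hu.act w

/-- The Weyl chamber is a fundamental domain on which the Weyl group acts freely after the shift
by `ρ`: the absolute values of the coordinates of `λ + ρ` are strictly decreasing, which leaves only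
the trivial permutation. -/
theorem IsDominant.eq_of_conjSign {n : ℕ} {lam lam' : Weight n} (h : IsDominant lam)
    (h' : IsDominant lam') {ε : ℤ} (hc : ConjSign ε (lam + rho n) (lam' + rho n)) :
    lam = lam' ∧ ε = 1 := by
  have habs : ∀ {μ : Weight n}, IsDominant μ → ∀ i j : Fin n, i < j →
      |(μ + rho n) j| < (μ + rho n) i := by
    intro μ hμ i j hij
    have := hμ i j hij
    have hi := i.2
    have hj := j.2
    have : i.val < j.val := hij
    rw [abs_lt]
    simp only [Pi.add_apply, rho]
    omega
  obtain ⟨⟨⟨s, π⟩, hs⟩, hw, rfl⟩ := hc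
  have hval : ∀ i, (lam' + rho n) i = (s i : ℤ) * (lam + rho n) (π.symm i) :=
    fun i => (congrFun hw i).symm
  have hval' : ∀ i, |(lam' + rho n) i| = |(lam + rho n) (π.symm i)| := by
    intro i
    rw [hval, abs_mul]
    rcases Int.units_eq_one_or (s i) with h1 | h1 <;> simp [h1]
  have hmono : StrictMono π.symm := by
    intro i j hij
    by_contra hcon
    have hne : π.symm j ≠ π.symm i := by simpa using hij.ne'
    have hlt := habs h _ _ (lt_of_le_of_ne (not_lt.mp hcon) hne)
    have hlt' := habs h' _ _ hij
    rw [← hval'] at hlt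
    have h1 := le_abs_self ((lam + rho n) (π.symm j))
    rw [← hval'] at h1
    have h2 := le_abs_self ((lam' + rho n) i)
    omega
  have hid : ⇑π.symm = id := by
    refine (hmono.range_inj strictMono_id).mp ?_
    simp
  have hs1 : ∀ i j : Fin n, i < j → s i = 1 := by
    intro i j hij
    have h1 := habs h _ _ hij
    have h2 := habs h' _ _ hij
    have h3 := hval i
    rw [hid] at h3
    rcases Int.units_eq_one_or (s i) with h0 | h0
    · exact h0
    · rw [h0] at h3
      have := abs_nonneg ((lam + rho n) j)
      have := abs_nonneg ((lam' + rho n) j)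
      simp only [id, Units.val_neg, Units.val_one] at h3
      omega
  have hs2 : ∀ i, s i = 1 := by
    intro i
    by_cases hi : ∃ j, i < j
    · obtain ⟨j, hj⟩ := hi
      exact hs1 i j hj
    · rw [← hs]
      refine (Finset.prod_eq_single i (fun j _ hj => ?_) (by simp)).symm
      push Not at hi
      exact hs1 j i (lt_of_le_of_ne (hi j) hj)
  constructor
  · ext i
    have := hval i
    rw [hid, hs2] at this
    simp only [Pi.add_apply, id, Units.val_one, one_mul] at this
    omega
  · have : π = 1 := by
      rw [← Equiv.symm_symm π, show π.symm = Equiv.refl _ from Equiv.ext (congrFun hid)]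
      rfl
    simp [weylSign, this]

theorem reducedSymbol_eq {K : Type*} [Field K] {n : ℕ} {ε : ℤ} {μ lam : Weight n}
    (h : IsDominant lam) (hc : ConjSign ε (μ + rho n) (lam + rho n)) :
    reducedSymbol K μ = Finsupp.single lam (ε : K) := by
  obtain ⟨w, hw, rfl⟩ := hc
  have hex : ∃ p : WeylGroup n × Weight n,
      IsDominant p.2 ∧ act p.1 (μ + rho n) = p.2 + rho n := ⟨(w, lam), h, hw⟩
  rw [reducedSymbol, dif_pos hex]
  obtain ⟨hd, ha⟩ := hex.choose_spec
  obtain ⟨h1, h2⟩ := hd.eq_of_conjSign h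
    (ConjSign.trans (ConjSign.symm ⟨_, ha, rfl⟩) ⟨w, hw, rfl⟩)
  have h3 : weylSign hex.choose.1 = weylSign w := by
    linear_combination weylSign w * h2 - weylSign hex.choose.1 * weylSign_mul_self w
  rw [h1, h3]

theorem reducedSymbol_eq_zero {K : Type*} [Field K] {n : ℕ} {μ : Weight n}
    (h : ¬ IsRegular (μ + rho n)) : reducedSymbol K μ = 0 := by
  rw [reducedSymbol, dif_neg]
  rintro ⟨p, hp, hw⟩
  exact h (hp.isRegular.of_conjSign (ConjSign.symm ⟨p.1, hw, rfl⟩))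

end TypeD

/-! ### The orbit of `omega n k` and the coefficients of the recurrence -/

namespace TypeD

/-- The number of nonzero coordinates. -/
def supp {n : ℕ} (μ : Weight n) : ℕ := (Finset.univ.filter fun i => μ i ≠ 0).card

/-- The coordinates lie in `{-1, 0, 1}`. -/
def IsTernary {n : ℕ} (μ : Weight n) : Prop := ∀ i, μ i = -1 ∨ μ i = 0 ∨ μ i = 1

theorem supp_le {n : ℕ} (μ : Weight n) : supp μ ≤ n := by
  simpa [supp] using Finset.card_le_univ (Finset.univ.filter fun i => μ i ≠ 0)

/-- The weight `e_1 + ⋯ + e_m`. -/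
def ones (n m : ℕ) : Weight n := fun i => if i.val < m then 1 else 0

theorem ones_two_mul (n k : ℕ) : ones n (2 * k) = omega n k := rfl

theorem supp_ones {n m : ℕ} (h : m ≤ n) : supp (ones n m) = m := by
  simp only [supp, ones]
  simpa [Fin.card_filter_val_lt] using h

theorem supp_omega {n k : ℕ} (h : 2 * k ≤ n) : supp (omega n k) = 2 * k :=
  supp_ones h

theorem prod_omega {n k : ℕ} (h : n = 2 * k) : ∏ i, omega n k i = 1 := by
  refine Finset.prod_eq_one fun i _ => ?_
  simp [omega, ← h]

theorem exists_zero_of_supp_lt {n : ℕ} {μ : Weight n} (h : supp μ < n) : ∃ i, μ i = 0 := by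
  by_contra hcon
  push Not at hcon
  simp [supp, hcon] at h

/-- The orbit of `omega n k`. Sign changes of a weight with a zero coordinate are not restricted
by parity, so the product of the coordinates matters only for `n = 2k`. -/
theorem mem_orbit_omega {n k : ℕ} (h : 2 * k ≤ n) (μ : Weight n) :
    μ ∈ orbit (omega n k) ↔ IsTernary μ ∧ supp μ = 2 * k ∧ (n = 2 * k → ∏ i, μ i = 1) := by
  simp only [orbit, Finset.mem_image, Finset.mem_univ, true_and]
  constructor
  · rintro ⟨⟨⟨s, π⟩, hs⟩, rfl⟩
    refine ⟨fun i => ?_, ?_, fun hn => ?_⟩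
    · simp only [act, omega]
      rcases Int.units_eq_one_or (s i) with h1 | h1 <;> simp only [h1] <;> split_ifs <;> simp
    · rw [← supp_omega h, supp, supp]
      refine Finset.card_bij (fun i _ => π.symm i) (by simp [act]) (by simp) (fun i hi => ?_)
      exact ⟨π i, by simpa [act] using hi, by simp⟩
    · have hs' : ∏ i, ((s i : ℤˣ) : ℤ) = 1 := by
        have := congrArg (fun u : ℤˣ => (u : ℤ)) hs
        simpa using this
      simp only [act, Finset.prod_mul_distrib, hs', one_mul]
      rw [Equiv.prod_comp π.symm (omega n k), prod_omega hn]
  · rintro ⟨ht, hsupp, hprod⟩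
    -- a permutation which carries the first `2k` coordinates to the support of `μ`
    obtain ⟨π, hπ⟩ : ∃ π : Equiv.Perm (Fin n), ∀ i, omega n k i ≠ 0 ↔ μ (π i) ≠ 0 := by
      have hc : Fintype.card {i // omega n k i ≠ 0} = Fintype.card {i // μ i ≠ 0} := by
        rw [Fintype.card_subtype, Fintype.card_subtype]
        exact (supp_omega h).trans hsupp.symm
      let e := Fintype.equivOfCardEq hc
      refine ⟨e.extendSubtype, fun i => ⟨fun hi => e.extendSubtype_mem i hi, fun hi => ?_⟩⟩
      by_contra hcon
      exact e.extendSubtype_not_mem i (not_not.mpr hcon) hi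
    let s₀ : Fin n → ℤˣ := fun i => if μ i = -1 then -1 else 1
    have hs₀ : ∀ s : Fin n → ℤˣ, (∀ i, μ i ≠ 0 → s i = s₀ i) →
        ∀ i, (s i : ℤ) * omega n k (π.symm i) = μ i := by
      intro s hs i
      have := hπ (π.symm i)
      rw [Equiv.apply_symm_apply] at this
      by_cases h0 : μ i = 0
      · have : omega n k (π.symm i) = 0 := by tauto
        simp [this, h0]
      · have : omega n k (π.symm i) = 1 := by
          have := this.mpr h0
          simp only [omega] at this ⊢
          split_ifs at this ⊢ <;> simp_all
        rw [this, hs i h0]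
        rcases ht i with h1 | h1 | h1 <;> simp_all [s₀]
    by_cases hprod₀ : ∏ i, s₀ i = 1
    · exact ⟨⟨(s₀, π), hprod₀⟩, funext fun i => hs₀ s₀ (fun _ _ => rfl) i⟩
    · -- the parity is corrected by a sign at a zero coordinate of `μ`, which does not move `μ`
      have hn : n ≠ 2 * k := by
        intro hn
        apply hprod₀
        have h2 : ∀ i, μ i = (s₀ i : ℤ) := by
          intro i
          have := hs₀ s₀ (fun _ _ => rfl) i
          rw [← this]
          have : (π.symm i).val < 2 * k := hn ▸ (π.symm i).2
          simp [omega, this]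
        have := hprod hn
        simp only [h2] at this
        exact Units.ext (by simpa using this)
      obtain ⟨j, hj⟩ := exists_zero_of_supp_lt (μ := μ) (by omega)
      refine ⟨⟨(Function.update s₀ j (-1), π), ?_⟩, funext fun i => hs₀ _ (fun i hi => ?_) i⟩
      · have h1 : s₀ j = 1 := by simp [s₀, hj]
        have h2 := Finset.mul_prod_erase Finset.univ s₀ (Finset.mem_univ j)
        rw [h1, one_mul] at h2
        rw [Finset.prod_update_of_mem (Finset.mem_univ j), ← Finset.erase_eq, h2,
          (Int.units_eq_one_or _).resolve_left hprod₀]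
        simp
      · have hij : i ≠ j := fun hij => hi (hij ▸ hj)
        show Function.update s₀ j (-1) i = s₀ i
        rw [Function.update_of_ne hij]

section

variable {K : Type*} [Field K]

/-- The summand of the recurrence contributed by the coordinate `x` in the position whose
`ρ`-coordinate is `r`, for the parameters `-q` and `t`. -/
def coordCoeff (q t : K) (x r : ℤ) : K :=
  if x = 0 then 0 else t ^ (-(r * x)) + q * t ^ (r * x)

/-- The closed form of `minusculeCoeff (-q) t (omega n k) μ` (see `minusculeCoeff_omega`). -/
def weightCoeff (q t : K) {n : ℕ} (μ : Weight n) : K := ∑ i, coordCoeff q t (μ i) (rho n i)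

/-- The vectors `w e_1` with `w (omega n k) = μ` are the `μ_i e_i` with `μ_i ≠ 0`. -/
theorem minusculeCoeff_omega (q t : K) {n k : ℕ} (hk : 1 ≤ k) (h : 2 * k ≤ n) {μ : Weight n}
    (hμ : μ ∈ orbit (omega n k)) :
    minusculeCoeff (-q) t (omega n k) μ = weightCoeff q t μ := by
  have hn : 0 < n := by omega
  obtain ⟨⟨⟨s, π⟩, hs⟩, -, hw⟩ := Finset.mem_image.mp hμ
  have hval : ∀ i, μ i = (s i : ℤ) * omega n k (π.symm i) := fun i => (congrFun hw i).symm
  have himage : ((Finset.univ.filter fun w : WeylGroup n => act w (omega n k) = μ).image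
      fun w => act w (e1 n)) =
      (Finset.univ.filter fun i => μ i ≠ 0).image fun i => (Pi.single i (μ i) : Weight n) := by
    ext φ
    simp only [Finset.mem_image, Finset.mem_filter, Finset.mem_univ, true_and]
    constructor
    · rintro ⟨⟨⟨s', π'⟩, hs'⟩, hw', rfl⟩
      have h0 : omega n k ⟨0, hn⟩ = 1 := by simp [omega]; omega
      have hval' : μ (π' ⟨0, hn⟩) = (s' (π' ⟨0, hn⟩) : ℤ) := by
        rw [← hw']
        simp [act, h0]
      refine ⟨π' ⟨0, hn⟩, by simp [hval'], ?_⟩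
      ext i
      by_cases hi : i = π' ⟨0, hn⟩
      · subst hi
        simp [act, e1, hval']
      · have : (π'.symm i).val ≠ 0 := by
          intro hcon
          apply hi
          rw [← Equiv.symm_apply_eq]
          exact Fin.ext hcon
        simp [act, e1, this, hi]
    · rintro ⟨i, hi, rfl⟩
      -- composing with a transposition in the stabiliser of the weight moves `e_1` to any
      -- coordinate vector of the support
      have hlt : (π.symm i).val < 2 * k := by
        by_contra hcon
        apply hi
        rw [hval]
        simp [omega, hcon]
      have hi1 : μ i = (s i : ℤ) := by
        rw [hval]
        simp [omega, hlt]
      refine ⟨⟨(s, π * Equiv.swap ⟨0, hn⟩ (π.symm i)), hs⟩, ?_, ?_⟩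
      · rw [← hw]
        ext l
        simp only [act, Equiv.Perm.mul_def, Equiv.symm_trans_apply, Equiv.symm_swap]
        congr 1
        rw [Equiv.swap_apply_def]
        split_ifs with h1 h2
        · rw [h1]
          simp [omega, hlt]; omega
        · rw [h2]
          simp [omega, hlt]; omega
        · rfl
      · ext l
        simp only [act, Equiv.Perm.mul_def, Equiv.symm_trans_apply, Equiv.symm_swap]
        by_cases hl : l = i
        · subst hl
          simp [e1, hi1]
        · have : (Equiv.swap ⟨0, hn⟩ (π.symm i) (π.symm l)).val ≠ 0 := by
            intro hcon
            apply hl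
            have h1 : Equiv.swap ⟨0, hn⟩ (π.symm i) (π.symm l) = ⟨0, hn⟩ := Fin.ext hcon
            rw [Equiv.swap_apply_eq_iff, Equiv.swap_apply_left] at h1
            exact π.symm.injective h1
          simp [e1, this, hl]
  have hpair : pair (omega n k) (e1 n) = 1 := by
    rw [pair, Finset.sum_eq_single ⟨0, hn⟩]
    · simp [omega, e1]; omega
    · intro i _ hi
      have : i.val ≠ 0 := fun hc => hi (Fin.ext hc)
      simp [e1, this]
    · simp
  have hpair' : ∀ i, pair (rho n) (Pi.single i (μ i)) = rho n i * μ i := by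
    intro i
    rw [pair, Finset.sum_eq_single i] <;> simp +contextual
  rw [minusculeCoeff, himage, Finset.sum_image, weightCoeff, Finset.sum_filter]
  · refine Finset.sum_congr rfl fun i _ => ?_
    rw [hpair, hpair', coordCoeff]
    by_cases hi : μ i = 0 <;> simp [hi, sub_eq_add_neg]
  · intro i hi j hj hij
    by_contra hne
    have := congrFun hij i
    simp only [Pi.single_eq_same, Pi.single_eq_of_ne hne] at this
    simp at hi
    exact hi this

end

end TypeD

/-! ### Regular shifted weights and the reduced recurrence -/

namespace TypeD

/-- The weights `μ` with coordinates in `{-1, 0, 1}` for which `μ + ρ` is conjugate to `ρ`. Such a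
`μ` exchanges the entries of `ρ` along a set of disjoint pairs of neighbouring positions, with
coordinates `-1, 1` at each pair; at the last pair, where `ρ` is `1, 0`, the coordinates
`-1, -1` do as well. -/
def matchings : (n : ℕ) → Finset (Weight n)
  | 0 => {0}
  | 1 => {0}
  | 2 => {![0, 0], ![-1, 1], ![-1, -1]}
  | n + 3 => (matchings (n + 2)).image (fun μ => (Fin.cons 0 μ : Weight (n + 3))) ∪
      (matchings (n + 1)).image (fun μ => (Fin.cons (-1) (Fin.cons 1 μ) : Weight (n + 3)))

/-- The weights that consist of `m` coordinates `1` followed by a member of `matchings (n - m)`. -/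
def shifted : (n m : ℕ) → Finset (Weight n)
  | n, 0 => matchings n
  | 0, _ + 1 => ∅
  | n + 1, m + 1 => (shifted n m).image (fun μ => (Fin.cons 1 μ : Weight (n + 1)))

/-- The weight `e_1 + ⋯ + e_{n-1} - e_n`. -/
def onesNeg (n : ℕ) : Weight n := fun i => if i.val + 1 = n then -1 else 1

theorem isDominant_ones (n m : ℕ) : IsDominant (ones n m) := by
  intro i j hij
  have : i.val < j.val := hij
  simp only [ones]
  split_ifs <;> omega

theorem supp_cons {n : ℕ} (x : ℤ) (μ : Weight n) :
    supp (Fin.cons x μ : Weight (n + 1)) = (if x = 0 then 0 else 1) + supp μ := by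
  simp only [supp, Finset.card_filter, Fin.sum_univ_succ, Fin.cons_zero, Fin.cons_succ]
  split_ifs <;> simp_all

theorem rho_succ (n : ℕ) : rho (n + 1) = Fin.cons (n : ℤ) (rho n) := by
  ext i
  refine Fin.cases ?_ (fun j => ?_) i
  · simp [rho]
  · simp [rho]
    ring

theorem cons_add_rho {n : ℕ} (x : ℤ) (μ : Weight n) :
    (Fin.cons x μ + rho (n + 1) : Weight (n + 1)) = Fin.cons (x + n) (μ + rho n) := by
  rw [rho_succ]
  ext i
  refine Fin.cases ?_ (fun j => ?_) i <;> simp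

theorem IsRegular.of_cons {n : ℕ} {x : ℤ} {v : Weight n}
    (h : IsRegular (Fin.cons x v : Weight (n + 1))) :
    (∀ i, x - v i ≠ 0 ∧ x + v i ≠ 0) ∧ IsRegular v :=
  ⟨fun i => by simpa using h 0 i.succ (Fin.succ_pos i),
    fun i j hij => by simpa using h i.succ j.succ (by simpa using hij)⟩

theorem cons_zero_mem_matchings {n : ℕ} {μ : Weight n} (h : μ ∈ matchings n) :
    (Fin.cons 0 μ : Weight (n + 1)) ∈ matchings (n + 1) := by
  match n, μ, h with
  | 0, μ, h => 
    simp only [matchings, Finset.mem_singleton]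
    ext i
    fin_cases i
    rfl
  | 1, μ, h =>
    simp only [matchings, Finset.mem_singleton] at h
    subst h
    simp only [matchings, Finset.mem_insert]
    left
    ext i
    fin_cases i <;> rfl
  | n + 2, μ, h =>
    simp only [matchings, Finset.mem_union, Finset.mem_image]
    exact Or.inl ⟨μ, h, rfl⟩

theorem cons_swap_mem_matchings {n : ℕ} {μ : Weight n} (h : μ ∈ matchings n) :
    (Fin.cons (-1) (Fin.cons 1 μ) : Weight (n + 2)) ∈ matchings (n + 2) := by
  match n, μ, h with
  | 0, μ, h =>
    simp only [matchings, Finset.mem_insert]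
    right; left
    ext i
    fin_cases i <;> rfl
  | n + 1, μ, h =>
    simp only [matchings, Finset.mem_union, Finset.mem_image]
    exact Or.inr ⟨μ, h, rfl⟩

theorem isTernary_cons {n : ℕ} {x : ℤ} {μ : Weight n} :
    IsTernary (Fin.cons x μ : Weight (n + 1)) ↔ (x = -1 ∨ x = 0 ∨ x = 1) ∧ IsTernary μ := by
  simp [IsTernary, Fin.forall_fin_succ]

/-- Induction along the recursion that defines `matchings`. -/
theorem matchings_induction {P : (n : ℕ) → Weight n → Prop} (h0 : P 0 0)
    (hneg : P 2 (Fin.cons (-1) (Fin.cons (-1) 0)))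
    (hcons : ∀ n μ, μ ∈ matchings n → P n μ → P (n + 1) (Fin.cons 0 μ))
    (hswap : ∀ n μ, μ ∈ matchings n → P n μ → P (n + 2) (Fin.cons (-1) (Fin.cons 1 μ))) :
    ∀ n (μ : Weight n), μ ∈ matchings n → P n μ
  | 0, μ, _ => by rwa [Subsingleton.elim μ 0]
  | 1, μ, h => by
    have := hcons 0 0 (by simp [matchings]) h0
    simp only [matchings, Finset.mem_singleton] at h
    convert this using 1
    rw [h]
    ext i
    fin_cases i
    rfl
  | 2, μ, h => by
    simp only [matchings, Finset.mem_insert, Finset.mem_singleton] at h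
    rcases h with rfl | rfl | rfl
    · convert hcons 1 _ (by simp [matchings]) (hcons 0 0 (by simp [matchings]) h0) using 1
      ext i; fin_cases i <;> rfl
    · convert hswap 0 0 (by simp [matchings]) h0 using 1
      ext i; fin_cases i <;> rfl
    · convert hneg using 1
      ext i; fin_cases i <;> rfl
  | n + 3, μ, h => by
    simp only [matchings, Finset.mem_union, Finset.mem_image] at h
    rcases h with ⟨ν, hν, rfl⟩ | ⟨ν, hν, rfl⟩
    · exact hcons _ _ hν (matchings_induction h0 hneg hcons hswap _ _ hν)
    · exact hswap _ _ hν (matchings_induction h0 hneg hcons hswap _ _ hν)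

theorem isTernary_of_mem_matchings {n : ℕ} {μ : Weight n} (h : μ ∈ matchings n) :
    IsTernary μ := by
  refine matchings_induction (P := fun n μ => IsTernary μ) ?_ ?_ ?_ ?_ n μ h
  · simp [IsTernary]
  · simp [IsTernary]
  · intro n μ _ h; simp [isTernary_cons, h]
  · intro n μ _ h; simp [isTernary_cons, h]

/-- Each exchange of neighbouring entries is undone by a transposition. At the last pair the
entry `0` of the shifted weight absorbs the sign change that parity asks for. -/
theorem exists_conjSign_of_mem_matchings {n : ℕ} {μ : Weight n} (h : μ ∈ matchings n) :
    ∃ j, supp μ = 2 * j ∧ ConjSign ((-1) ^ j) (μ + rho n) (rho n) := by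
  refine matchings_induction
    (P := fun n μ => ∃ j, supp μ = 2 * j ∧ ConjSign ((-1) ^ j) (μ + rho n) (rho n))
    ?_ ?_ ?_ ?_ n μ h
  · exact ⟨0, by simp [supp], by rw [pow_zero, zero_add]; exact ConjSign.refl _⟩
  · refine ⟨1, by rw [supp_cons, supp_cons]; simp [supp], ?_⟩
    have := ConjSign.of_perm (n := 2) (v := Fin.cons (-1) (Fin.cons (-1) 0) + rho 2) (v' := rho 2)
      (fun _ => -1) (Equiv.swap 0 1) (by simp) (fun i => by fin_cases i <;> simp [rho])
    simpa using this
  · rintro n μ - ⟨j, hj, hc⟩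
    refine ⟨j, by simp [supp_cons, hj], ?_⟩
    rw [cons_add_rho, rho_succ, zero_add]
    exact hc.cons _
  · rintro n μ - ⟨j, hj, hc⟩
    refine ⟨j + 1, by simp [supp_cons, hj]; omega, ?_⟩
    rw [cons_add_rho, cons_add_rho, rho_succ, rho_succ, pow_succ]
    convert (ConjSign.cons (ConjSign.cons hc _) _).trans
      (ConjSign.swap ((n : ℤ)) (n + 1 : ℤ) (rho n)) using 3
    · push_cast; ring
    · ring
    · push_cast; ring

/-- The entry `n - 1` of `ρ` is attained, up to sign, by `μ + ρ`. -/
theorem exists_eq_or_eq_neg_of_mem_matchings {n : ℕ} {μ : Weight n} (h : μ ∈ matchings n)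
    (hn : 1 ≤ n) : ∃ i, (μ + rho n) i = n - 1 ∨ (μ + rho n) i = -(n - 1) := by
  refine matchings_induction (P := fun n μ => 1 ≤ n → ∃ i, (μ + rho n) i = n - 1 ∨
    (μ + rho n) i = -(n - 1)) ?_ ?_ ?_ ?_ n μ h hn
  · intro h; omega
  · exact fun _ => ⟨1, by simp [rho]⟩
  · exact fun n μ _ _ _ => ⟨0, by simp [rho]⟩
  · exact fun n μ _ _ _ => ⟨1, by simp [rho]⟩

theorem isTernary_of_mem_shifted {n m : ℕ} {μ : Weight n} (h : μ ∈ shifted n m) :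
    IsTernary μ := by
  induction m generalizing n with
  | zero => exact isTernary_of_mem_matchings (by rwa [shifted] at h)
  | succ m ih =>
    cases n with
    | zero => simp [shifted] at h
    | succ n =>
      simp only [shifted, Finset.mem_image] at h
      obtain ⟨ν, hν, rfl⟩ := h
      simp [isTernary_cons, ih hν]

theorem exists_conjSign_of_mem_shifted {n m : ℕ} {μ : Weight n} (h : μ ∈ shifted n m) :
    m ≤ n ∧ ∃ j, supp μ = m + 2 * j ∧ ConjSign ((-1) ^ j) (μ + rho n) (ones n m + rho n) := by
  induction m generalizing n with
  | zero =>
    refine ⟨Nat.zero_le _, ?_⟩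
    obtain ⟨j, hj, hc⟩ := exists_conjSign_of_mem_matchings (by rwa [shifted] at h)
    have h0 : ones n 0 = 0 := by ext i; simp [ones]
    exact ⟨j, by omega, by simpa [h0] using hc⟩
  | succ m ih =>
    cases n with
    | zero => simp [shifted] at h
    | succ n =>
      simp only [shifted, Finset.mem_image] at h
      obtain ⟨ν, hν, rfl⟩ := h
      obtain ⟨hm, j, hj, hc⟩ := ih hν
      refine ⟨by omega, j, by simp [supp_cons, hj]; omega, ?_⟩
      have h1 : ones (n + 1) (m + 1) = Fin.cons 1 (ones n m) := by
        ext i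
        refine Fin.cases ?_ (fun j => ?_) i <;> simp [ones]
      rw [h1, cons_add_rho, cons_add_rho]
      exact hc.cons _

theorem shifted_apply_of_lt {n m : ℕ} {μ : Weight n} (h : μ ∈ shifted n m) (i : Fin n)
    (hi : i.val < m) : μ i = 1 := by
  induction m generalizing n with
  | zero => omega
  | succ m ih =>
    cases n with
    | zero => exact i.elim0
    | succ n =>
      simp only [shifted, Finset.mem_image] at h
      obtain ⟨ν, hν, rfl⟩ := h
      revert hi
      refine Fin.cases (by simp) (fun j hj => ?_) i
      simpa using ih hν j (by simpa using hj)

/-- A weight with coordinates in `{-1, 0, 1}` whose `ρ`-shift is regular consists of a run of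
ones, which shifts the top entries of `ρ`, followed by exchanges of neighbouring entries. The one
exception is the run through all positions whose last coordinate has the opposite sign. -/
theorem mem_shifted_of_isRegular {n : ℕ} {μ : Weight n} (ht : IsTernary μ)
    (hr : IsRegular (μ + rho n)) : (∃ m, μ ∈ shifted n m) ∨ (1 ≤ n ∧ μ = onesNeg n) := by
  induction n with
  | zero => exact Or.inl ⟨0, by simp [shifted, matchings, Subsingleton.elim μ 0]⟩
  | succ n ih =>
    obtain ⟨x, ν, rfl⟩ : ∃ (x : ℤ) (ν : Weight n), μ = Fin.cons x ν :=
      ⟨μ 0, Fin.tail μ, (Fin.cons_self_tail μ).symm⟩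
    rw [isTernary_cons] at ht
    rw [cons_add_rho] at hr
    obtain ⟨hx, ht⟩ := ht
    obtain ⟨hne, hr⟩ := hr.of_cons
    simp only [Pi.add_apply] at hne
    rcases ih ht hr with ⟨m, hm⟩ | ⟨hn, rfl⟩
    · rcases hx with rfl | rfl | rfl
      · rcases Nat.eq_zero_or_pos n with rfl | hn
        · refine Or.inr ⟨le_rfl, ?_⟩
          ext i
          fin_cases i
          rfl
        · match m with
          | 0 =>
            exfalso
            obtain ⟨i, hi⟩ := exists_eq_or_eq_neg_of_mem_matchings (by rwa [shifted] at hm) hn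
            have := hne i
            simp only [Pi.add_apply] at hi
            omega
          | 1 =>
            left
            obtain ⟨n, rfl⟩ : ∃ n', n = n' + 1 := ⟨n - 1, by omega⟩
            rw [shifted, shifted, Finset.mem_image] at hm
            obtain ⟨ν', hν', rfl⟩ := hm
            exact ⟨0, by rw [shifted]; exact cons_swap_mem_matchings hν'⟩
          | m + 2 =>
            exfalso
            have hmn := (exists_conjSign_of_mem_shifted hm).1
            have h1 := shifted_apply_of_lt hm ⟨1, by omega⟩ (by simp)
            have := hne ⟨1, by omega⟩
            rw [h1] at this
            simp only [rho] at this
            push_cast at this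
            omega
      · match m with
        | 0 =>
          rw [shifted] at hm
          exact Or.inl ⟨0, by rw [shifted]; exact cons_zero_mem_matchings hm⟩
        | m + 1 =>
          exfalso
          have hmn := (exists_conjSign_of_mem_shifted hm).1
          have h1 := shifted_apply_of_lt hm ⟨0, by omega⟩ (by simp)
          have := hne ⟨0, by omega⟩
          rw [h1] at this
          simp only [rho] at this
          push_cast at this
          omega
      · exact Or.inl ⟨m + 1, by rw [shifted, Finset.mem_image]; exact ⟨ν, hm, rfl⟩⟩
    · rcases hx with rfl | rfl | rfl
      · rcases Nat.lt_or_ge 1 n with hn1 | hn1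
        · exfalso
          have := hne ⟨1, hn1⟩
          simp only [onesNeg, rho] at this
          split_ifs at this <;> push_cast at this <;> omega
        · obtain rfl : n = 1 := by omega
          refine Or.inl ⟨0, ?_⟩
          simp only [shifted, matchings, Finset.mem_insert, Finset.mem_singleton]
          right; right
          ext i
          fin_cases i <;> rfl
      · exfalso
        have := hne ⟨0, hn⟩
        simp only [onesNeg, rho] at this
        split_ifs at this <;> push_cast at this <;> omega
      · refine Or.inr ⟨by omega, ?_⟩
        ext i
        refine Fin.cases ?_ (fun j => ?_) i
        · simp [onesNeg]; omega
        · simp [onesNeg]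

theorem supp_onesNeg (n : ℕ) : supp (onesNeg n) = n := by
  have : ∀ i : Fin n, onesNeg n i ≠ 0 := fun i => by simp only [onesNeg]; split_ifs <;> simp
  simp [supp, this]

theorem prod_onesNeg {n : ℕ} (hn : 1 ≤ n) : ∏ i, onesNeg n i = -1 := by
  obtain ⟨n, rfl⟩ : ∃ n', n = n' + 1 := ⟨n - 1, by omega⟩
  rw [Fin.prod_univ_castSucc, Finset.prod_eq_one]
  · simp [onesNeg]
  · intro i _
    have := i.2
    simp [onesNeg]
    omega

theorem onesNeg_notMem_orbit {n k : ℕ} (h : 2 * k ≤ n) (hn : 1 ≤ n) :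
    onesNeg n ∉ orbit (omega n k) := by
  rw [mem_orbit_omega h]
  rintro ⟨-, h1, h2⟩
  rw [supp_onesNeg] at h1
  have := h2 h1
  rw [prod_onesNeg hn] at this
  omega

/-- In the orbit of `omega n k`, regularity of the `ρ`-shift means conjugacy to some
`omega n h`. -/
theorem exists_mem_shifted_of_mem_orbit {n k : ℕ} (h : 2 * k ≤ n) {μ : Weight n}
    (hμ : μ ∈ orbit (omega n k)) (hr : IsRegular (μ + rho n)) :
    ∃ h', h' ≤ k ∧ μ ∈ shifted n (2 * h') := by
  have ho := (mem_orbit_omega h μ).mp hμ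
  rcases mem_shifted_of_isRegular ho.1 hr with ⟨m, hm⟩ | ⟨hn, rfl⟩
  · obtain ⟨-, j, hj, -⟩ := exists_conjSign_of_mem_shifted hm
    refine ⟨m / 2, by omega, ?_⟩
    rwa [show 2 * (m / 2) = m by omega]
  · exact absurd hμ (onesNeg_notMem_orbit h hn)

theorem conjSign_of_mem_shifted {n k h : ℕ} {μ : Weight n} (hμ : μ ∈ shifted n (2 * h))
    (hs : supp μ = 2 * k) :
    ConjSign ((-1) ^ (k - h)) (μ + rho n) (omega n h + rho n) := by
  obtain ⟨-, j, hj, hc⟩ := exists_conjSign_of_mem_shifted hμ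
  rwa [show k - h = j by omega]

theorem mem_Omega {n k h : ℕ} (hkn : 2 * k ≤ n) (hhn : 2 * h ≤ n) {μ : Weight n} :
    μ ∈ Omega n k h ↔ μ ∈ shifted n (2 * h) ∧ supp μ = 2 * k ∧ (n = 2 * k → ∏ i, μ i = 1) := by
  simp only [Omega, Finset.mem_filter]
  constructor
  · rintro ⟨ho, w, hw⟩
    have hdom := isDominant_ones n (2 * h)
    have hc : ConjSign (weylSign w) (μ + rho n) (ones n (2 * h) + rho n) := ⟨w, hw, rfl⟩
    obtain ⟨h', -, hh'⟩ := exists_mem_shifted_of_mem_orbit hkn ho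
      (hdom.isRegular.of_conjSign hc.symm)
    obtain ⟨hle, j, hj, hc'⟩ := exists_conjSign_of_mem_shifted hh'
    have h1 := (hdom.eq_of_conjSign (isDominant_ones n (2 * h')) (hc.symm.trans hc')).1
    have h2 := congrArg supp h1
    rw [supp_ones hhn, supp_ones hle] at h2
    rw [h2]
    exact ⟨hh', ((mem_orbit_omega hkn μ).mp ho).2⟩
  · rintro ⟨hs, h1, h2⟩
    obtain ⟨w, hw, -⟩ := conjSign_of_mem_shifted hs h1
    exact ⟨(mem_orbit_omega hkn μ).mpr ⟨isTernary_of_mem_shifted hs, h1, h2⟩, w, hw⟩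

section

variable {K : Type*} [Field K]

theorem Omega_subset_orbit (n k h : ℕ) : Omega n k h ⊆ orbit (omega n k) := by
  classical
  exact Finset.filter_subset _ _

theorem conj_of_mem_Omega {n k h : ℕ} {μ : Weight n} (hμ : μ ∈ Omega n k h) :
    Conj μ (omega n h) := by
  classical
  exact (Finset.mem_filter.mp hμ).2

theorem reducedSymbol_eq_sum {n k : ℕ} (h : 2 * k ≤ n) {μ : Weight n}
    (hμ : μ ∈ orbit (omega n k)) :
    reducedSymbol K μ = ∑ h ∈ Finset.range (k + 1),
      if μ ∈ Omega n k h then Finsupp.single (omega n h) ((-1) ^ (k - h) : K) else 0 := by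
  have hsymb : ∀ h', h' ≤ k → μ ∈ Omega n k h' →
      reducedSymbol K μ = Finsupp.single (omega n h') ((-1) ^ (k - h') : K) := by
    intro h' hh' hm
    rw [mem_Omega h (by omega)] at hm
    rw [reducedSymbol_eq (isDominant_ones n (2 * h')) (conjSign_of_mem_shifted hm.1 hm.2.1)]
    simp [ones_two_mul]
  by_cases hr : IsRegular (μ + rho n)
  · obtain ⟨h', hh', hm⟩ := exists_mem_shifted_of_mem_orbit h hμ hr
    have hm' : μ ∈ Omega n k h' :=
      (mem_Omega h (by omega)).mpr ⟨hm, ((mem_orbit_omega h μ).mp hμ).2⟩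
    rw [Finset.sum_eq_single h', if_pos hm', hsymb h' hh' hm']
    · intro l hl hne
      rw [if_neg]
      intro hl'
      have hlk : l ≤ k := by simpa [Nat.lt_succ_iff] using hl
      have h1 := (hsymb h' hh' hm').symm.trans (hsymb l hlk hl')
      rw [Finsupp.single_eq_single_iff] at h1
      rcases h1 with ⟨h1, -⟩ | ⟨h1, -⟩
      · have h2 := congrArg supp h1
        rw [supp_omega (by omega), supp_omega (by omega)] at h2
        omega
      · exact pow_ne_zero _ (by simp) h1
    · simp; omega
  · rw [reducedSymbol_eq_zero hr, Finset.sum_eq_zero]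
    intro l _
    rw [if_neg]
    intro hl
    obtain ⟨w, hw⟩ := conj_of_mem_Omega hl
    exact hr ((isDominant_ones n (2 * l)).isRegular.of_conjSign (ConjSign.symm ⟨w, hw, rfl⟩))

/-- The total coefficient with which the weights conjugated to `omega n h` enter the recurrence
for `omega n k`. -/
noncomputable def omegaSum (q t : K) (n k h : ℕ) : K := ∑ μ ∈ Omega n k h, weightCoeff q t μ

theorem reduce_minusculeRecurrence (q t : K) {n k : ℕ} (hk : 1 ≤ k) (h : 2 * k ≤ n) :
    reduce (minusculeRecurrence (-q) t (omega n k)) =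
      ∑ h ∈ Finset.range (k + 1),
        Finsupp.single (omega n h) ((-1) ^ (k - h) * omegaSum q t n k h) := by
  simp only [minusculeRecurrence, reduce, map_sum, Finsupp.linearCombination_single, omegaSum]
  rw [Finset.sum_congr rfl fun μ hμ => by
    rw [reducedSymbol_eq_sum h hμ, minusculeCoeff_omega q t hk h hμ, Finset.smul_sum]]
  rw [Finset.sum_comm]
  refine Finset.sum_congr rfl fun h _ => ?_
  rw [Finset.mul_sum, Finsupp.single_finsetSum]
  simp only [smul_ite, smul_zero]
  rw [← Finset.sum_filter, Finset.filter_mem_eq_inter,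
    Finset.inter_eq_right.mpr (Omega_subset_orbit n k h)]
  refine Finset.sum_congr rfl fun μ _ => ?_
  rw [Finsupp.smul_single, smul_eq_mul, mul_comm]

/-- An extended family takes the same value on a symbol and on its reduced form. -/
theorem IsExtendedFamily.linearCombination_reducedSymbol {n k : ℕ} {C : Weight n → K}
    (hC : IsExtendedFamily C) (h : 2 * k ≤ n) {μ : Weight n} (hμ : μ ∈ orbit (omega n k)) :
    Finsupp.linearCombination K C (reducedSymbol K μ) = C μ := by
  by_cases hr : IsRegular (μ + rho n)
  · obtain ⟨h', -, hm⟩ := exists_mem_shifted_of_mem_orbit h hμ hr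
    have hc := conjSign_of_mem_shifted hm ((mem_orbit_omega h μ).mp hμ).2.1
    have hdom := isDominant_ones n (2 * h')
    rw [reducedSymbol_eq hdom hc]
    obtain ⟨w, hw, hs⟩ := hc
    rw [hC.2 μ _ w hdom hw, Finsupp.linearCombination_single, hs, smul_eq_mul]
  · rw [reducedSymbol_eq_zero hr, map_zero, hC.1 μ hr]

theorem IsExtendedFamily.linearCombination_reduce {n k : ℕ} {C : Weight n → K}
    (hC : IsExtendedFamily C) (h : 2 * k ≤ n) (q t : K) :
    Finsupp.linearCombination K C (reduce (minusculeRecurrence q t (omega n k))) =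
      ∑ μ ∈ orbit (omega n k), minusculeCoeff q t (omega n k) μ * C μ := by
  simp only [minusculeRecurrence, reduce, map_sum, Finsupp.linearCombination_single, map_smul]
  refine Finset.sum_congr rfl fun μ hμ => ?_
  rw [hC.linearCombination_reducedSymbol h hμ, smul_eq_mul]

end

end TypeD

/-! ### Generating polynomials of the conjugated weights -/

namespace TypeD

open Polynomial

section

variable {K : Type*} [Field K]

theorem cons_injective {n : ℕ} (x : ℤ) :
    Function.Injective fun μ : Weight n => (Fin.cons x μ : Weight (n + 1)) :=
  Fin.cons_right_injective (α := fun _ => ℤ) x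

theorem sum_matchings_two {M : Type*} [AddCommMonoid M] (f : Weight 2 → M) :
    ∑ μ ∈ matchings 2, f μ = f ![0, 0] + f ![-1, 1] + f ![-1, -1] := by
  rw [matchings, Finset.sum_insert (by decide), Finset.sum_insert (by decide),
    Finset.sum_singleton, add_assoc]

theorem sum_matchings_succ {M : Type*} [AddCommMonoid M] (n : ℕ) (f : Weight (n + 3) → M) :
    ∑ μ ∈ matchings (n + 3), f μ = ∑ μ ∈ matchings (n + 2), f (Fin.cons 0 μ) +
      ∑ μ ∈ matchings (n + 1), f (Fin.cons (-1) (Fin.cons 1 μ)) := by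
  rw [matchings, Finset.sum_union, Finset.sum_image, Finset.sum_image]
  · exact fun μ _ ν _ h => cons_injective _ (cons_injective _ h)
  · exact fun μ _ ν _ h => cons_injective _ h
  · rw [Finset.disjoint_left]
    simp only [Finset.mem_image, not_exists, not_and]
    rintro μ ⟨ν, -, rfl⟩ ν' - h
    simpa using congrFun h 0

theorem weightCoeff_cons (q t : K) {n : ℕ} (x : ℤ) (μ : Weight n) :
    weightCoeff q t (Fin.cons x μ : Weight (n + 1)) =
      coordCoeff q t x n + weightCoeff q t μ := by
  simp [weightCoeff, Fin.sum_univ_succ, rho_succ]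

/-- The contribution to the recurrence of an exchange of the entries `r + 1` and `r` of `ρ`. -/
def edgeCoeff (q t : K) (r : ℕ) : K := coordCoeff q t (-1) (r + 1) + coordCoeff q t 1 r

theorem coordCoeff_zero (q t : K) (r : ℤ) : coordCoeff q t 0 r = 0 := by simp [coordCoeff]

theorem weightCoeff_cons_swap (q t : K) {n : ℕ} (μ : Weight n) :
    weightCoeff q t (Fin.cons (-1) (Fin.cons 1 μ) : Weight (n + 2)) =
      edgeCoeff q t n + weightCoeff q t μ := by
  rw [weightCoeff_cons, weightCoeff_cons, edgeCoeff]
  push_cast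
  ring

theorem weightCoeff_two (q t : K) :
    weightCoeff q t (![0, 0] : Weight 2) = 0 ∧
    weightCoeff q t (![-1, 1] : Weight 2) = edgeCoeff q t 0 ∧
    weightCoeff q t (![-1, -1] : Weight 2) = edgeCoeff q t 0 := by
  simp [weightCoeff, edgeCoeff, coordCoeff, rho]

/-- The signed generating polynomial of `matchings n`, with weights `f`, by the number of
coordinates `0`. -/
noncomputable def genPoly {n : ℕ} (f : Weight n → K) : K[X] :=
  ∑ μ ∈ matchings n, monomial (n - supp μ) ((-1) ^ (supp μ / 2) * f μ)

theorem genPoly_add {n : ℕ} (f g : Weight n → K) :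
    genPoly (fun μ => f μ + g μ) = genPoly f + genPoly g := by
  simp [genPoly, mul_add, Finset.sum_add_distrib]

theorem genPoly_const {n : ℕ} (c : K) :
    genPoly (fun _ : Weight n => c) = C c * genPoly (fun _ : Weight n => 1) := by
  simp only [genPoly, Finset.mul_sum, C_mul_monomial, mul_one]
  simp only [mul_comm]

theorem genPoly_one (f : Weight 1 → K) : genPoly f = C (f 0) * X := by
  have : supp (0 : Weight 1) = 0 := by simp [supp]
  simp [genPoly, matchings, this, C_mul_X_eq_monomial]

theorem genPoly_two (f : Weight 2 → K) :
    genPoly f = C (f ![0, 0]) * X ^ 2 - C (f ![-1, 1] + f ![-1, -1]) := by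
  have h0 : supp (![0, 0] : Weight 2) = 0 := by decide
  have h1 : supp (![-1, 1] : Weight 2) = 2 := by decide
  have h2 : supp (![-1, -1] : Weight 2) = 2 := by decide
  simp only [genPoly, sum_matchings_two, h0, h1, h2]
  simp [C_mul_X_pow_eq_monomial]
  ring

/-- The recursion for `genPoly`; the sign comes from the pair of nonzero coordinates that is
removed in the second term. -/
theorem genPoly_succ (n : ℕ) (f : Weight (n + 3) → K) :
    genPoly f = X * genPoly (fun μ : Weight (n + 2) => f (Fin.cons 0 μ)) -
      genPoly (fun μ : Weight (n + 1) => f (Fin.cons (-1) (Fin.cons 1 μ))) := by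
  simp only [genPoly, sum_matchings_succ, Finset.mul_sum, sub_eq_add_neg, ← Finset.sum_neg_distrib]
  congr 1
  · refine Finset.sum_congr rfl fun μ _ => ?_
    have := supp_le μ
    rw [X_mul_monomial, supp_cons]
    congr 2
    · simp; omega
    · simp
  · refine Finset.sum_congr rfl fun μ _ => ?_
    have := supp_le μ
    rw [supp_cons, supp_cons, ← map_neg]
    have h1 : n + 3 - ((if (-1 : ℤ) = 0 then 0 else 1) + ((if (1 : ℤ) = 0 then 0 else 1) + supp μ))
        = n + 1 - supp μ := by simp; omega
    have h2 : ((if (-1 : ℤ) = 0 then 0 else 1) + ((if (1 : ℤ) = 0 then 0 else 1) + supp μ)) / 2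
        = supp μ / 2 + 1 := by simp; omega
    rw [h1, h2, pow_succ]
    congr 1
    ring

/-- The recursion of `matchings` is the three-term recursion of the Chebyshev polynomials. -/
theorem genPoly_eq_chebyshev (n : ℕ) :
    genPoly (fun _ : Weight (n + 1) => (1 : K)) = Chebyshev.C K (n + 1 : ℕ) := by
  induction n using Nat.twoStepInduction with
  | zero => simp [genPoly_one]
  | one =>
    rw [genPoly_two]
    have : (1 : K) + 1 = 2 := by norm_num
    simp [Chebyshev.C_two, this, map_ofNat]
  | more n ih1 ih2 =>
    rw [genPoly_succ, ih1, ih2]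
    have := Chebyshev.C_add_two K ((n + 1 : ℕ) : ℤ)
    push_cast at this ⊢
    rw [show (n : ℤ) + 2 + 1 = n + 1 + 2 by ring, this, show (n : ℤ) + 1 + 1 = n + 1 + 1 by ring]

/-- The sum of `edgeCoeff` over the lowest `m` pairs of neighbouring positions. -/
def edgeSum (q t : K) (m : ℕ) : K := ∑ r ∈ Finset.range m, edgeCoeff q t r

/-- The expansion, in the polynomials `Chebyshev.C`, of the negative of the generating polynomial
`genPoly` for the weights `weightCoeff`. -/
noncomputable def edgePoly (q t : K) (n : ℕ) : K[X] :=
  ∑ h ∈ Finset.range n, C (edgeSum q t h) * Chebyshev.C K ((n : ℤ) - 2 * h)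

/-- The recursion of `edgePoly` is that of `genPoly` for the weights `weightCoeff`: multiplication
by `X` splits `Chebyshev.C m` into its two neighbours, and the sums telescope. -/
theorem edgePoly_add_two (q t : K) (n : ℕ) :
    edgePoly q t (n + 2) = X * edgePoly q t (n + 1) - edgePoly q t n +
      C (edgeCoeff q t n) * Chebyshev.C K n := by
  have hX : X * edgePoly q t (n + 1) = ∑ h ∈ Finset.range (n + 1),
      (C (edgeSum q t h) * Chebyshev.C K ((n + 2 : ℕ) - 2 * h : ℤ) +
        C (edgeSum q t h) * Chebyshev.C K ((n : ℤ) - 2 * h)) := by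
    rw [edgePoly, Finset.mul_sum]
    refine Finset.sum_congr rfl fun h _ => ?_
    have := Chebyshev.C_add_two K ((n : ℤ) - 2 * h)
    rw [show ((n + 2 : ℕ) : ℤ) - 2 * h = (n : ℤ) - 2 * h + 2 by push_cast; ring, this,
      show ((n + 1 : ℕ) : ℤ) - 2 * h = (n : ℤ) - 2 * h + 1 by push_cast; ring]
    ring
  rw [hX, Finset.sum_add_distrib, edgePoly, edgePoly, Finset.sum_range_succ _ (n + 1),
    Finset.sum_range_succ (fun h => C (edgeSum q t h) * Chebyshev.C K ((n : ℤ) - 2 * h)) n,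
    show ((n + 2 : ℕ) : ℤ) - 2 * (n + 1 : ℕ) = -n by push_cast; ring,
    show (n : ℤ) - 2 * n = -n by ring, Chebyshev.C_neg,
    show edgeSum q t (n + 1) = edgeSum q t n + edgeCoeff q t n by
      rw [edgeSum, Finset.sum_range_succ, edgeSum], C_add]
  ring

theorem genPoly_weightCoeff (q t : K) (n : ℕ) :
    genPoly (fun μ : Weight (n + 1) => weightCoeff q t μ) = -edgePoly q t (n + 1) := by
  induction n using Nat.twoStepInduction with
  | zero => simp [genPoly_one, edgePoly, edgeSum, weightCoeff, coordCoeff]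
  | one =>
    obtain ⟨h0, h1, h2⟩ := weightCoeff_two q t
    rw [genPoly_two, h0, h1, h2]
    simp [edgePoly, edgeSum, Finset.sum_range_succ]
    ring
  | more n ih1 ih2 =>
    rw [genPoly_succ, edgePoly_add_two]
    simp only [weightCoeff_cons_swap]
    rw [genPoly_add, genPoly_const, genPoly_eq_chebyshev, ih1]
    simp only [weightCoeff_cons, coordCoeff_zero, zero_add, ih2]
    ring

/-- At the last pair the two choices of sign contribute equally, with opposite products of the
coordinates. -/
theorem sum_prod_matchings (q t : K) (n : ℕ) :
    ∑ μ ∈ matchings (n + 1), ((∏ i, μ i : ℤ) : K) = 0 ∧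
      ∑ μ ∈ matchings (n + 1), ((∏ i, μ i : ℤ) : K) * weightCoeff q t μ = 0 := by
  induction n using Nat.twoStepInduction with
  | zero => simp [matchings]
  | one =>
    obtain ⟨h0, h1, h2⟩ := weightCoeff_two q t
    rw [sum_matchings_two, sum_matchings_two, h0, h1, h2]
    simp [Fin.prod_univ_succ]
  | more n ih1 ih2 =>
    rw [sum_matchings_succ, sum_matchings_succ]
    simp only [weightCoeff_cons_swap, Fin.prod_univ_succ, Fin.cons_zero, Fin.cons_succ]
    obtain ⟨h1, h2⟩ := ih1
    simp only [Fin.prod_univ_succ, Int.cast_mul, Int.cast_prod] at h1 h2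
    simp [mul_add, Finset.sum_add_distrib, ← Finset.sum_mul, h1, h2]

theorem coeff_genPoly {n j : ℕ} (h : 2 * j ≤ n) (f : Weight n → K) :
    (genPoly f).coeff (n - 2 * j) =
      (-1) ^ j * ∑ μ ∈ matchings n with supp μ = 2 * j, f μ := by
  rw [genPoly, finsetSum_coeff, Finset.mul_sum, Finset.sum_filter]
  refine Finset.sum_congr rfl fun μ _ => ?_
  have := supp_le μ
  rw [coeff_monomial]
  by_cases hs : supp μ = 2 * j
  · rw [if_pos (by omega), if_pos hs, hs, Nat.mul_div_cancel_left _ (by norm_num)]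
  · rw [if_neg (by omega), if_neg hs]

theorem prod_eq_zero_of_supp_ne {n : ℕ} {μ : Weight n} (h : supp μ ≠ n) : ∏ i, μ i = 0 := by
  obtain ⟨i, hi⟩ := exists_zero_of_supp_lt (lt_of_le_of_ne (supp_le μ) h)
  exact Finset.prod_eq_zero (Finset.mem_univ i) hi

theorem prod_eq_of_isTernary {n : ℕ} {μ : Weight n} (ht : IsTernary μ) (h : supp μ = n) :
    ∏ i, μ i = 1 ∨ ∏ i, μ i = -1 := by
  rw [← Int.isUnit_iff, IsUnit.prod_univ_iff]
  intro i
  rw [Int.isUnit_iff]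
  have : μ i ≠ 0 := by
    intro hi
    have : supp μ < n := by
      have := Finset.card_lt_univ_of_notMem (s := Finset.univ.filter fun i => μ i ≠ 0) (x := i)
        (by simp [hi])
      simpa [supp] using this
    omega
  have := ht i
  tauto

theorem Omega_zero {n j : ℕ} (h : 2 * j ≤ n) :
    Omega n j 0 = (matchings n).filter fun μ => supp μ = 2 * j ∧ (n = 2 * j → ∏ i, μ i = 1) := by
  ext μ
  rw [mem_Omega h (by omega), Finset.mem_filter, Nat.mul_zero, shifted]

/-- For `n = 2j`, when no coordinate vanishes, exactly half of the weighted count of `matchings n`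
satisfies the parity condition of the orbit. -/
theorem sum_Omega_zero {n j : ℕ} (h : 2 * j ≤ n) (f : Weight n → K)
    (hf : ∑ μ ∈ matchings n, ((∏ i, μ i : ℤ) : K) * f μ = 0) :
    (if n = 2 * j then 2 else 1) * ∑ μ ∈ Omega n j 0, f μ =
      (-1) ^ j * (genPoly f).coeff (n - 2 * j) := by
  rw [coeff_genPoly h, ← mul_assoc, ← mul_pow, neg_one_mul, neg_neg, one_pow, one_mul,
    Omega_zero h]
  split_ifs with hn
  · rw [← add_zero (∑ μ ∈ matchings n with supp μ = 2 * j, f μ), ← hf, Finset.sum_filter,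
      Finset.sum_filter, Finset.mul_sum, ← Finset.sum_add_distrib]
    refine Finset.sum_congr rfl fun μ hμ => ?_
    by_cases hs : supp μ = 2 * j
    · rcases prod_eq_of_isTernary (isTernary_of_mem_matchings hμ) (hs.trans hn.symm) with h1 | h1
      · simp only [hs, h1]
        simp
        ring
      · simp [hs, h1, hn]
    · simp [hs, prod_eq_zero_of_supp_ne (μ := μ) (by omega)]
  · simp [hn]

theorem card_Omega_zero {n j : ℕ} (hn : 1 ≤ n) (h : 2 * j ≤ n) :
    (if n = 2 * j then 2 else 1) * ((Omega n j 0).card : K) =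
      (-1) ^ j * (Chebyshev.C K n).coeff (n - 2 * j) := by
  obtain ⟨n, rfl⟩ : ∃ n', n = n' + 1 := ⟨n - 1, by omega⟩
  rw [← genPoly_eq_chebyshev, ← sum_Omega_zero h]
  · simp
  · simpa using (sum_prod_matchings (1 : K) 1 n).1

theorem omegaSum_zero (q t : K) {n j : ℕ} (hn : 1 ≤ n) (h : 2 * j ≤ n) :
    (if n = 2 * j then 2 else 1) * omegaSum q t n j 0 =
      (-1) ^ j * -(edgePoly q t n).coeff (n - 2 * j) := by
  obtain ⟨n, rfl⟩ : ∃ n', n = n' + 1 := ⟨n - 1, by omega⟩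
  rw [← coeff_neg, ← genPoly_weightCoeff, ← sum_Omega_zero h, omegaSum]
  exact (sum_prod_matchings q t n).2

theorem Omega_zero_zero (n : ℕ) : Omega n 0 0 = {0} := by
  have hsupp : ∀ μ : Weight n, supp μ = 0 ↔ μ = 0 := by
    intro μ
    simp [supp, Finset.filter_eq_empty_iff, funext_iff]
  have h0 : (0 : Weight n) ∈ matchings n := by
    induction n with
    | zero => simp [matchings]
    | succ n ih =>
      convert cons_zero_mem_matchings (ih (fun μ => by
        simp [supp, Finset.filter_eq_empty_iff, funext_iff])) using 1
      ext i
      refine Fin.cases ?_ (fun j => ?_) i <;> simp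
  rw [Omega_zero (by omega)]
  ext μ
  simp only [Finset.mem_filter, Finset.mem_singleton, Nat.mul_zero, hsupp]
  constructor
  · rintro ⟨-, h, -⟩
    exact h
  · rintro rfl
    refine ⟨h0, rfl, ?_⟩
    rintro rfl
    simp

theorem omegaSum_zero_zero (q t : K) (n : ℕ) : omegaSum q t n 0 0 = 0 := by
  simp [omegaSum, Omega_zero_zero, weightCoeff, coordCoeff]

theorem Theta_self (n h : ℕ) : Theta n h h = 1 := by
  rw [Theta, Nat.sub_self, Omega_zero_zero, Finset.card_singleton]

/-- Counts and weighted sums over `shifted (n + m) m` in terms of `matchings n`; the condition `c`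
carries the parity restriction. -/
theorem sum_shifted (q t : K) (n m s : ℕ) (c : Prop) [Decidable c] :
    ((shifted (n + m) m).filter fun μ => supp μ = m + s ∧ (c → ∏ i, μ i = 1)).card =
      ((matchings n).filter fun μ => supp μ = s ∧ (c → ∏ i, μ i = 1)).card ∧
    ∑ μ ∈ (shifted (n + m) m).filter fun μ => supp μ = m + s ∧ (c → ∏ i, μ i = 1),
        weightCoeff q t μ =
      (∑ i ∈ Finset.range m, coordCoeff q t 1 (n + i : ℕ)) *
        ((matchings n).filter fun μ => supp μ = s ∧ (c → ∏ i, μ i = 1)).card +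
      ∑ μ ∈ (matchings n).filter fun μ => supp μ = s ∧ (c → ∏ i, μ i = 1),
        weightCoeff q t μ := by
  induction m with
  | zero => simp [shifted]
  | succ m ih =>
    have h1 : ((shifted (n + (m + 1)) (m + 1)).filter
        fun μ => supp μ = m + 1 + s ∧ (c → ∏ i, μ i = 1)) =
        ((shifted (n + m) m).filter fun μ => supp μ = m + s ∧ (c → ∏ i, μ i = 1)).image
          (fun μ => (Fin.cons 1 μ : Weight (n + m + 1))) := by
      change ((shifted (n + m + 1) (m + 1)).filter
        fun μ => supp μ = m + 1 + s ∧ (c → ∏ i, μ i = 1)) = _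
      rw [shifted, Finset.filter_image]
      congr 1
      refine Finset.filter_congr fun μ _ => ?_
      rw [supp_cons, Fin.prod_univ_succ]
      simp only [Fin.cons_zero, Fin.cons_succ, one_mul]
      simp
      omega
    rw [h1, Finset.card_image_of_injective _ (cons_injective 1)]
    refine ⟨ih.1, (Finset.sum_image fun μ _ ν _ h => cons_injective 1 h).trans ?_⟩
    simp only [weightCoeff_cons]
    rw [Finset.sum_add_distrib, Finset.sum_const, ih.1, ih.2, Finset.sum_range_succ, nsmul_eq_mul]
    ring

/-- The contribution to the recurrence of the `m` coordinates `1` in front of a member of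
`shifted n m`. -/
def topSum (q t : K) (n m : ℕ) : K := ∑ i ∈ Finset.range m, coordCoeff q t 1 (n - m + i : ℕ)

theorem omegaSum_eq (q t : K) {n k h : ℕ} (hh : h ≤ k) (hk : 2 * k ≤ n) :
    omegaSum q t n k h = topSum q t n (2 * h) * (Theta n k h : K) +
      omegaSum q t (n - 2 * h) (k - h) 0 := by
  obtain ⟨N, rfl⟩ : ∃ N, n = N + 2 * h := ⟨n - 2 * h, by omega⟩
  obtain ⟨j, rfl⟩ : ∃ j, k = h + j := ⟨k - h, by omega⟩
  have h1 : Omega (N + 2 * h) (h + j) h = (shifted (N + 2 * h) (2 * h)).filter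
      fun μ => supp μ = 2 * h + 2 * j ∧ (N = 2 * j → ∏ i, μ i = 1) := by
    ext μ
    rw [mem_Omega hk (by omega), Finset.mem_filter, ← mul_add]
    have : N + 2 * h = 2 * (h + j) ↔ N = 2 * j := by omega
    rw [this]
  have h2 := (sum_shifted q t N (2 * h) (2 * j) (N = 2 * j)).2
  rw [← h1, ← Omega_zero (by omega)] at h2
  have h3 : Theta (N + 2 * h) (h + j) h = (Omega N j 0).card := by
    rw [Theta, Nat.add_sub_cancel, Nat.add_sub_cancel_left]
  rw [h3]
  simp only [topSum, Nat.add_sub_cancel, Nat.add_sub_cancel_left]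
  exact h2

end

end TypeD

/-! ### The coefficients `A` and the elimination -/

namespace TypeD

open Polynomial

theorem A_self {n k : ℕ} (hk : 1 ≤ k) : A n k k = 1 := by
  rw [A, if_neg (by omega), if_pos rfl]

/-- The recursion for `A`, read as a linear relation. -/
theorem sum_A_mul_Theta {n k h : ℕ} (h0 : 1 ≤ h) (hk : h < k) :
    ∑ i ∈ Finset.Icc h k, (-1) ^ (i - h) * (Theta n i h : ℤ) * A n k i = 0 := by
  rw [← Finset.add_sum_Ioc_eq_sum_Icc hk.le, A, if_neg (by omega), if_neg (by omega),
    ← Finset.sum_attach (Finset.Ioc h k)]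
  simp [Theta_self]

section

variable {K : Type*} [Field K]

theorem natDegree_chebyshev_C_le (m : ℕ) : (Chebyshev.C K m).natDegree ≤ m := by
  induction m using Nat.twoStepInduction with
  | zero => simp
  | one => simp
  | more m ih1 ih2 =>
    have := Chebyshev.C_add_two K m
    push_cast at this ih2 ⊢
    rw [this]
    refine (natDegree_sub_le _ _).trans (max_le ?_ (by omega))
    refine natDegree_mul_le.trans ?_
    rw [natDegree_X]
    omega

theorem coeff_chebyshev_C_eq_zero {m : ℤ} {j : ℕ} (h : m.natAbs < j) :
    (Chebyshev.C K m).coeff j = 0 := by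
  rw [← Chebyshev.C_natAbs]
  exact coeff_eq_zero_of_natDegree_lt ((natDegree_chebyshev_C_le _).trans_lt h)

/-- The factor by which the parity condition on orbits reduces the count of `matchings`: it is `2`
if no coordinate vanishes and `1` otherwise. -/
def parityFactor (K : Type*) [Field K] (n i : ℕ) : K := if n = 2 * i then 2 else 1

theorem parityFactor_sub {n i h : ℕ} (hi : h ≤ i) (hn : 2 * i ≤ n) :
    (if n - 2 * h = 2 * (i - h) then (2 : K) else 1) = parityFactor K n i := by
  rw [parityFactor]
  congr 1
  exact propext (by omega)

theorem parityFactor_ne_zero [CharZero K] (n i : ℕ) : parityFactor K n i ≠ 0 := by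
  rw [parityFactor]
  split_ifs <;> norm_num

/-- The numbers `Theta n i l` are, up to sign and `parityFactor`, the coefficients of the Chebyshev
polynomials. -/
theorem coeff_chebyshev_C {n l i : ℕ} (hl : l ≤ i) (hi : 2 * i ≤ n) :
    (Chebyshev.C K ((n : ℤ) - 2 * l)).coeff (n - 2 * i) =
      (-1) ^ (i - l) * (parityFactor K n i * (Theta n i l : K)) := by
  have hcast : (n : ℤ) - 2 * l = ((n - 2 * l : ℕ) : ℤ) := by omega
  rw [hcast, ← parityFactor_sub hl hi]
  rcases Nat.eq_zero_or_pos (n - 2 * l) with h0 | h0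
  · obtain rfl : i = l := by omega
    simp [h0, Theta_self]
  · rw [Theta, card_Omega_zero h0 (by omega), ← mul_assoc, ← mul_pow, neg_one_mul, neg_neg,
      one_pow, one_mul]
    congr 1
    omega

/-- The linear functional that weights the coefficient of `X ^ (n - 2i)`, for `h < i ≤ k`, with
`A n k i`, divided by `parityFactor` to make up for the halved counts. It is dual to the polynomials
`Chebyshev.C` (see `dualA_chebyshev_C`). -/
noncomputable def dualA (K : Type*) [Field K] (n k h : ℕ) : K[X] →ₗ[K] K :=
  ∑ i ∈ Finset.Ioc h k, ((A n k i : K) / parityFactor K n i) • lcoeff K (n - 2 * i)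

theorem dualA_apply (n k h : ℕ) (p : K[X]) :
    dualA K n k h p =
      ∑ i ∈ Finset.Ioc h k, (A n k i : K) / parityFactor K n i * p.coeff (n - 2 * i) := by
  simp [dualA, LinearMap.sum_apply]

/-- The relation `sum_A_mul_Theta` says that `dualA` annihilates `Chebyshev.C (n - 2l)`, unless
`l = k`. -/
theorem dualA_chebyshev_C [CharZero K] {n k h l : ℕ} (hl : h < l) (hlk : l ≤ k)
    (hkn : 2 * k ≤ n) :
    dualA K n k h (Chebyshev.C K ((n : ℤ) - 2 * l)) = if l = k then 1 else 0 := by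
  have hsub : Finset.Icc l k ⊆ Finset.Ioc h k := fun i hi => by
    rw [Finset.mem_Icc] at hi
    rw [Finset.mem_Ioc]
    omega
  rw [dualA_apply, ← Finset.sum_subset hsub]
  · have h1 : ∀ i ∈ Finset.Icc l k, (A n k i : K) / parityFactor K n i *
        (Chebyshev.C K ((n : ℤ) - 2 * l)).coeff (n - 2 * i) =
        (((-1) ^ (i - l) * (Theta n i l : ℤ) * A n k i : ℤ) : K) := by
      intro i hi
      rw [Finset.mem_Icc] at hi
      rw [coeff_chebyshev_C hi.1 (by omega)]
      have := parityFactor_ne_zero (K := K) n i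
      push_cast
      field_simp
    rw [Finset.sum_congr rfl h1, ← Int.cast_sum]
    split_ifs with hl'
    · subst hl'
      simp [Theta_self, A_self (show 1 ≤ l by omega)]
    · rw [sum_A_mul_Theta (by omega) (by omega), Int.cast_zero]
  · intro i hi hi'
    rw [Finset.mem_Ioc] at hi
    rw [Finset.mem_Icc] at hi'
    rw [coeff_chebyshev_C_eq_zero (by omega), mul_zero]

/-- `dualA` on all the polynomials that occur in `edgePoly`: those of negative index are covered
by `Chebyshev.C_neg`. -/
theorem dualA_chebyshev_C_sub [CharZero K] {n k h l : ℕ} (hk : h < k) (hkn : 2 * k ≤ n)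
    (hl : 1 ≤ l) (hl' : l < n - 2 * h) :
    dualA K n k h (Chebyshev.C K (((n - 2 * h : ℕ) : ℤ) - 2 * l)) =
      if l = k - h ∨ l = n - h - k then 1 else 0 := by
  rcases le_or_gt l (k - h) with h1 | h1
  · rw [show ((n - 2 * h : ℕ) : ℤ) - 2 * l = (n : ℤ) - 2 * (l + h : ℕ) by omega,
      dualA_chebyshev_C (by omega) (by omega) hkn]
    congr 1
    exact propext (by omega)
  · rcases le_or_gt (n - h - k) l with h2 | h2
    · rw [show ((n - 2 * h : ℕ) : ℤ) - 2 * l = -((n : ℤ) - 2 * (n - h - l : ℕ)) by omega,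
        Chebyshev.C_neg, dualA_chebyshev_C (by omega) (by omega) hkn]
      congr 1
      exact propext (by omega)
    · rw [if_neg (by omega), dualA_apply]
      refine Finset.sum_eq_zero fun i hi => ?_
      rw [Finset.mem_Ioc] at hi
      rw [coeff_chebyshev_C_eq_zero (by omega), mul_zero]

theorem dualA_edgePoly [CharZero K] (q t : K) {n k h : ℕ} (hk : h < k) (hkn : 2 * k ≤ n) :
    dualA K n k h (edgePoly q t (n - 2 * h)) =
      if n = 2 * k then edgeSum q t (k - h)
      else edgeSum q t (k - h) + edgeSum q t (n - h - k) := by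
  have h1 : ∀ l ∈ Finset.range (n - 2 * h),
      dualA K n k h (C (edgeSum q t l) * Chebyshev.C K (((n - 2 * h : ℕ) : ℤ) - 2 * l)) =
        if l = k - h ∨ l = n - h - k then edgeSum q t l else 0 := by
    intro l hl
    rw [Finset.mem_range] at hl
    rw [C_mul', map_smul, smul_eq_mul]
    rcases Nat.eq_zero_or_pos l with rfl | h0
    · simp [edgeSum]
    · rw [dualA_chebyshev_C_sub hk hkn h0 hl, mul_ite, mul_one, mul_zero]
  rw [edgePoly, map_sum, Finset.sum_congr rfl h1]
  split_ifs with hn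
  · have : n - h - k = k - h := by omega
    simp only [this, or_self]
    rw [Finset.sum_ite_eq' , if_pos (Finset.mem_range.mpr (by omega))]
  · have h2 : ∀ l ∈ Finset.range (n - 2 * h),
        (if l = k - h ∨ l = n - h - k then edgeSum q t l else 0) =
          (if l = k - h then edgeSum q t l else 0) +
            if l = n - h - k then edgeSum q t l else 0 := by
      intro l _
      by_cases ha : l = k - h
      · simp only [ha, true_or, if_true]
        rw [if_neg (by omega), add_zero]
      · simp [ha]
    rw [Finset.sum_congr rfl h2, Finset.sum_add_distrib, Finset.sum_ite_eq', Finset.sum_ite_eq',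
      if_pos (Finset.mem_range.mpr (by omega)), if_pos (Finset.mem_range.mpr (by omega))]

theorem sum_A_mul_omegaSum_zero [CharZero K] (q t : K) {n k h : ℕ} (hk : h < k)
    (hkn : 2 * k ≤ n) :
    ∑ i ∈ Finset.Ioc h k, (A n k i : K) * ((-1) ^ (i - h) * omegaSum q t (n - 2 * h) (i - h) 0) =
      -dualA K n k h (edgePoly q t (n - 2 * h)) := by
  rw [dualA_apply, ← Finset.sum_neg_distrib]
  refine Finset.sum_congr rfl fun i hi => ?_
  rw [Finset.mem_Ioc] at hi
  have h1 := omegaSum_zero q t (n := n - 2 * h) (j := i - h) (by omega) (by omega)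
  rw [parityFactor_sub hi.1.le (by omega), show n - 2 * h - 2 * (i - h) = n - 2 * i by omega] at h1
  have h2 := parityFactor_ne_zero (K := K) n i
  have h3 : ((-1 : K) ^ (i - h)) * (-1) ^ (i - h) = 1 := by
    rw [← mul_pow, neg_one_mul, neg_neg, one_pow]
  have h4 : (edgePoly q t (n - 2 * h)).coeff (n - 2 * i) =
      -((-1) ^ (i - h) * (parityFactor K n i * omegaSum q t (n - 2 * h) (i - h) 0)) := by
    rw [h1]
    linear_combination (-(edgePoly q t (n - 2 * h)).coeff (n - 2 * i)) * h3
  rw [h4]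
  field_simp

/-- For `h ≥ 1` the contributions of the leading ones cancel by `sum_A_mul_Theta`; for `h = 0` there
are no leading ones. -/
theorem sum_A_mul_omegaSum [CharZero K] (q t : K) {n k h : ℕ} (hk : h < k) (hkn : 2 * k ≤ n) :
    ∑ i ∈ Finset.Icc (max 1 h) k, (A n k i : K) * ((-1) ^ (i - h) * omegaSum q t n i h) =
      -dualA K n k h (edgePoly q t (n - 2 * h)) := by
  rw [← sum_A_mul_omegaSum_zero q t hk hkn]
  have hexp : ∀ i ∈ Finset.Icc (max 1 h) k,
      (A n k i : K) * ((-1) ^ (i - h) * omegaSum q t n i h) =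
        topSum q t n (2 * h) * (((-1) ^ (i - h) * (Theta n i h : ℤ) * A n k i : ℤ) : K) +
        (A n k i : K) * ((-1) ^ (i - h) * omegaSum q t (n - 2 * h) (i - h) 0) := by
    intro i hi
    rw [Finset.mem_Icc] at hi
    rw [omegaSum_eq q t (by omega) (by omega)]
    push_cast
    ring
  rw [Finset.sum_congr rfl hexp, Finset.sum_add_distrib, ← Finset.mul_sum, ← Int.cast_sum]
  rcases Nat.eq_zero_or_pos h with rfl | h0
  · simp only [topSum, Nat.mul_zero, Finset.range_zero, Finset.sum_empty, zero_mul, zero_add]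
    rfl
  · rw [max_eq_right h0, sum_A_mul_Theta h0 hk, Int.cast_zero, mul_zero, zero_add,
      ← Finset.add_sum_Ioc_eq_sum_Icc hk.le, Nat.sub_self, omegaSum_zero_zero]
    simp

/-- The elimination of the symbols: only the leading coefficient and the constants given by
`dualA_edgePoly` survive. -/
theorem sum_A_smul_reduce [CharZero K] (q t : K) {n k : ℕ} (hk : 1 ≤ k) (hkn : 2 * k ≤ n) :
    ∑ i ∈ Finset.Icc 1 k, (A n k i : K) • reduce (minusculeRecurrence (-q) t (omega n i)) =
      Finsupp.single (omega n k) (topSum q t n (2 * k)) -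
        ∑ h ∈ Finset.range k, Finsupp.single (omega n h)
          (dualA K n k h (edgePoly q t (n - 2 * h))) := by
  have h1 : ∀ i ∈ Finset.Icc 1 k,
      (A n k i : K) • reduce (minusculeRecurrence (-q) t (omega n i)) =
        ∑ h ∈ Finset.range (i + 1), Finsupp.single (omega n h)
          ((A n k i : K) * ((-1) ^ (i - h) * omegaSum q t n i h)) := by
    intro i hi
    rw [Finset.mem_Icc] at hi
    rw [reduce_minusculeRecurrence q t hi.1 (by omega), Finset.smul_sum]
    exact Finset.sum_congr rfl fun h _ => by rw [Finsupp.smul_single, smul_eq_mul]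
  rw [Finset.sum_congr rfl h1, Finset.sum_comm' (s' := fun h => Finset.Icc (max 1 h) k)
    (t' := Finset.range (k + 1))]
  · rw [Finset.sum_range_succ, add_comm, sub_eq_add_neg, ← Finset.sum_neg_distrib]
    congr 1
    · rw [max_eq_right hk, Finset.Icc_self, Finset.sum_singleton, A_self hk, Nat.sub_self,
        omegaSum_eq q t le_rfl hkn, Theta_self, Nat.sub_self, omegaSum_zero_zero]
      congr 1
      push_cast
      ring
    · refine Finset.sum_congr rfl fun h hh => ?_
      rw [← Finsupp.single_finsetSum, sum_A_mul_omegaSum q t (Finset.mem_range.mp hh) hkn,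
        Finsupp.single_neg]
  · intro i h
    simp only [Finset.mem_Icc, Finset.mem_range]
    omega

theorem reduce_minusculeRecurrence_apply_self (q t : K) {n k : ℕ} (hk : 1 ≤ k)
    (hkn : 2 * k ≤ n) :
    reduce (minusculeRecurrence (-q) t (omega n k)) (omega n k) = topSum q t n (2 * k) := by
  rw [reduce_minusculeRecurrence q t hk hkn, Finsupp.finsetSum_apply, Finset.sum_eq_single k]
  · simp [omegaSum_eq q t le_rfl hkn, Theta_self, omegaSum_zero_zero]
  · intro h hh hne
    rw [Finset.mem_range] at hh
    refine Finsupp.single_eq_of_ne fun heq => hne ?_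
    have := congrArg supp heq
    rw [supp_omega (by omega), supp_omega (by omega)] at this
    omega
  · simp

/-! ### Geometric sums -/

theorem edgeCoeff_eq (q t : K) (r : ℕ) :
    edgeCoeff q t r = t ^ (r + 1) + q * (t ^ (r + 1))⁻¹ + ((t ^ r)⁻¹ + q * t ^ r) := by
  rw [edgeCoeff, coordCoeff, coordCoeff, if_neg (by norm_num), if_neg (by norm_num), mul_neg,
    neg_neg, mul_one, mul_one, zpow_neg, zpow_neg, ← Nat.cast_succ, zpow_natCast, zpow_natCast]

theorem edgeSum_eq {q : K} (hq : q ≠ 0) (hq1 : q ≠ 1) (m : ℕ) :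
    edgeSum q (q ^ 2) m = (q * (q ^ 2) ^ m - q * ((q ^ 2) ^ m)⁻¹) / (q - 1) := by
  have h1 : q - 1 ≠ 0 := sub_ne_zero.mpr hq1
  rw [edgeSum]
  induction m with
  | zero => simp
  | succ m ih =>
    rw [Finset.sum_range_succ, ih, edgeCoeff_eq, pow_succ (q ^ 2) m]
    have : (q ^ 2) ^ m ≠ 0 := pow_ne_zero _ (pow_ne_zero _ hq)
    generalize (q ^ 2) ^ m = u at this
    field_simp
    ring

theorem sum_coordCoeff_one {q t : K} (ht : t ≠ 0) (ht1 : t ≠ 1) (a m : ℕ) :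
    ∑ i ∈ Finset.range m, coordCoeff q t 1 (a + i : ℕ) =
      (t * (t ^ a)⁻¹ - t * (t ^ (a + m))⁻¹ + q * (t ^ (a + m) - t ^ a)) / (t - 1) := by
  have h1 : t - 1 ≠ 0 := sub_ne_zero.mpr ht1
  induction m with
  | zero => simp
  | succ m ih =>
    rw [Finset.sum_range_succ, ih, coordCoeff, if_neg (by norm_num), mul_one, zpow_neg,
      zpow_natCast, show a + (m + 1) = a + m + 1 from rfl, pow_succ t (a + m)]
    have : t ^ (a + m) ≠ 0 := pow_ne_zero _ ht
    have : t ^ a ≠ 0 := pow_ne_zero _ ht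
    generalize t ^ (a + m) = u at *
    generalize t ^ a = v at *
    field_simp
    ring

end

theorem q_ne_zero : q ≠ 0 := RatFunc.X_ne_zero

theorem q_pow_ne_one {m : ℕ} (hm : m ≠ 0) : q ^ m ≠ 1 := by
  rw [q, ← RatFunc.algebraMap_X, ← map_pow, ← map_one (algebraMap ℂ[X] (RatFunc ℂ)),
    (RatFunc.algebraMap_injective ℂ).ne_iff]
  intro h
  have := congrArg natDegree h
  simp [hm] at this

theorem q_zpow_natCast_mul (a : ℤ) (m : ℕ) : q ^ (a * m) = (q ^ m) ^ a := by
  rw [mul_comm, zpow_mul, zpow_natCast]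

theorem b_eq {k n : ℕ} (hkn : 2 * k ≤ n) :
    b k n = if n = 2 * k then edgeSum q (q ^ 2) k
      else edgeSum q (q ^ 2) k + edgeSum q (q ^ 2) (n - k) := by
  have hq := q_ne_zero
  have hq1 : q ≠ 1 := by simpa using q_pow_ne_one one_ne_zero
  have hq1' : q - 1 ≠ 0 := sub_ne_zero.mpr hq1
  obtain ⟨m, rfl⟩ : ∃ m, n = k + m := ⟨n - k, by omega⟩
  rw [b, edgeSum_eq hq hq1, edgeSum_eq hq hq1, Nat.add_sub_cancel_left, ← pow_mul, ← pow_mul,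
    mul_comm 2 k, mul_comm 2 m, pow_mul, pow_mul]
  have hu : q ^ k ≠ 0 := pow_ne_zero _ hq
  have hv : q ^ m ≠ 0 := pow_ne_zero _ hq
  rw [show 2 * ((k + m : ℕ) : ℤ) = 2 * k + 2 * m by push_cast; ring,
    show 2 * (((k + m : ℕ) : ℤ) - 2 * k) = 2 * m - 2 * k by push_cast; ring,
    show 2 * (((k + m : ℕ) : ℤ) - k) - 1 = 2 * m - 1 by push_cast; ring]
  simp only [zpow_add₀ hq, zpow_sub₀ hq, q_zpow_natCast_mul, zpow_one]
  generalize q ^ k = u at *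
  generalize q ^ m = v at *
  congr 1
  · norm_cast
    field_simp
  · norm_cast
    field_simp
    ring

theorem topSum_eq {k n : ℕ} (hkn : 2 * k ≤ n) :
    topSum q (q ^ 2) n (2 * k) =
      (q ^ (4 * (k : ℤ)) - 1) * (q ^ (4 * ((n : ℤ) - k) - 1) + 1) /
        (q ^ (2 * ((n : ℤ) - 1)) * (q ^ 2 - 1)) := by
  have hq := q_ne_zero
  have hq2 : q ^ 2 - 1 ≠ 0 := sub_ne_zero.mpr (q_pow_ne_one two_ne_zero)
  obtain ⟨m, rfl⟩ : ∃ m, n = m + 2 * k := ⟨n - 2 * k, by omega⟩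
  rw [topSum, Nat.add_sub_cancel, sum_coordCoeff_one (pow_ne_zero _ hq) (q_pow_ne_one two_ne_zero),
    pow_add, mul_comm 2 k, pow_mul (q ^ 2) k, ← pow_mul, ← pow_mul q, mul_comm 2 m, mul_comm 2 k,
    pow_mul q m, pow_mul q k]
  have hu : q ^ k ≠ 0 := pow_ne_zero _ hq
  have hv : q ^ m ≠ 0 := pow_ne_zero _ hq
  rw [show 4 * (((m + k * 2 : ℕ) : ℤ) - k) - 1 = 4 * m + 4 * k - 1 by push_cast; ring,
    show 2 * (((m + k * 2 : ℕ) : ℤ) - 1) = 2 * m + 4 * k - 2 by push_cast; ring]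
  simp only [zpow_add₀ hq, zpow_sub₀ hq, q_zpow_natCast_mul, zpow_one]
  generalize q ^ k = u at *
  generalize q ^ m = v at *
  norm_cast
  field_simp
  ring

theorem sum_A_smul_R {n k : ℕ} (hk : 1 ≤ k) (hkn : 2 * k ≤ n) :
    ∑ i ∈ Finset.Icc 1 k, (A n k i : Kq) • R n i =
      Lambda n k k • Csym n k - ∑ i ∈ Finset.range k, b (k - i) (n - 2 * i) • Csym n i := by
  have h := sum_A_smul_reduce q (q ^ 2) hk hkn
  simp only [R, Lambda, Csym, reduce_minusculeRecurrence_apply_self q (q ^ 2) hk hkn]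
  rw [h]
  simp only [Finsupp.smul_single, smul_eq_mul, mul_one]
  congr 1
  refine Finset.sum_congr rfl fun i hi => ?_
  rw [Finset.mem_range] at hi
  rw [dualA_edgePoly q (q ^ 2) hi hkn, b_eq (by omega),
    show n - 2 * i - (k - i) = n - i - k by omega]
  congr 1
  exact if_congr (by omega) rfl rfl

end TypeD

theorem mainTheorem2 (n k : ℕ) (hk : 1 ≤ k) (hkn : 2 * k ≤ n) :
    (∑ i ∈ Finset.Icc 1 k, (TypeD.A n k i : TypeD.Kq) • TypeD.R n i =
      TypeD.Lambda n k k • TypeD.Csym n k -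
        ∑ i ∈ Finset.range k, TypeD.b (k - i) (n - 2 * i) • TypeD.Csym n i) ∧
    TypeD.Lambda n k k =
      (TypeD.q ^ (4 * (k : ℤ)) - 1) * (TypeD.q ^ (4 * ((n : ℤ) - k) - 1) + 1) /
        (TypeD.q ^ (2 * ((n : ℤ) - 1)) * (TypeD.q ^ 2 - 1)) ∧
    (∀ C : TypeD.Weight n → TypeD.Kq, TypeD.IsExtendedFamily C →
      ∑ i ∈ Finset.Icc 1 k, (TypeD.A n k i : TypeD.Kq) *
          ∑ μ ∈ TypeD.orbit (TypeD.omega n i),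
            TypeD.minusculeCoeff (-TypeD.q) (TypeD.q ^ 2) (TypeD.omega n i) μ * C μ =
        TypeD.Lambda n k k * C (TypeD.omega n k) -
          ∑ i ∈ Finset.range k, TypeD.b (k - i) (n - 2 * i) * C (TypeD.omega n i)) := by
  refine ⟨TypeD.sum_A_smul_R hk hkn, ?_, fun C hC => ?_⟩
  · rw [TypeD.Lambda, TypeD.R, TypeD.reduce_minusculeRecurrence_apply_self _ _ hk hkn,
      TypeD.topSum_eq hkn]
  · have h := congrArg (Finsupp.linearCombination TypeD.Kq C) (TypeD.sum_A_smul_R hk hkn)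
    simp only [map_sum, map_sub, map_smul, TypeD.Csym, Finsupp.linearCombination_single,
      smul_eq_mul, one_mul] at h
    rw [← h]
    refine Finset.sum_congr rfl fun i hi => ?_
    rw [Finset.mem_Icc] at hi
    rw [TypeD.R, hC.linearCombination_reduce (by omega)]
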